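/- Consider a game with $N\ge 2$ coalitions; coalition $i\in\{1,\dots,N\}$ has $m_i\ge 1$ agents, and some coalition $j$ has exactly one agent, $m_j=1$. Agent $k$ of coalition $i$ has action $x_{ik}\in\mathbb R$ and objective $f_{ik}:\mathbb R^{M}\to\mathbb R$, where $M=\sum_i m_i$ and $\mathbf x=(x_{ik})\in\mathbb R^M$; the cost of coalition $i$ is $f_i=\sum_{k=1}^{m_i}f_{ik}$. Write $\mathbf x_i=(x_{i1},\dots,x_{im_i})$. Assume: (a) every $f_{ik}$ is $\mathcal C^2$; (b) the pseudo-gradient $\mathcal P(\mathbf x)=\big(\partial f_i(\mathbf x)/\partial x_{ik}\big)_{i,k}$ is strictly monotone: $(\mathbf x-\mathbf y)^T(\mathcal P(\mathbf x)-\mathcal P(\mathbf y))>0$ for all $\mathbf x\ne\mathbf y$; (c) $\mathbf x^*\in\mathbb R^M$ is a Nash equilibrium: for every $i$, $\mathbf x_i^*$ minimizes $\mathbf x_i\mapsto f_i(\mathbf x_i,\mathbf x_{-i}^*)$ over $\mathbb R^{m_i}$. The interference graph $\mathcal G_I^i$ has the agents of coalition $i$ as vertices; distinct agents $k,l$ are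 adjacent iff $f_{ik}$ explicitly depends on $x_{il}$ or $f_{il}$ explicitly depends on $x_{ik}$. Let $\mathcal N_{Ik}^i$ be the set of neighbours of $k$ in it, $\bar{\mathcal N}^i_k=\mathcal N_{Ik}^i\cup\{k\}$ and $n_{ik}=|\bar{\mathcal N}^i_k|$. The agents of coalition $i$ communicate over a weighted graph $\mathcal G_C^i$ with adjacency matrix $(a_i^{kl})$, $a_i^{kl}\ge 0$, $a_i^{kk}=0$; $\mathcal G_{C_k}^i$ denotes the subgraph of $\mathcal G_C^i$ induced on $\bar{\mathcal N}_k^i$. Assume that for all $i\ne j$ and $k\in\{1,\dots,m_i\}$ the graphs $\mathcal G_I^i$ and $\mathcal G_{C_k}^i$ are undirected and connected. With fixed $\bar d_{ik}>0$ and a parameter $\delta>0$, the seeking strategy is $$\dot x_{ik}=-\delta\bar d_{ik}\,g_{ikk},\qquad \dot w_{ilk}=-\sum_{q\in\bar{\mathcal N}_k^i}a_i^{lq}(g_{ilk}-g_{iqk}),\qquad g_{ilk}=w_{ilk}+\frac{\partial f_{il}(\mathbf x)}{\partial x_{ik}},\qquad w_{ilk}(0)=0,$$ for all $i$, $k\in\{1,\dots,m_i\}$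 and $l\in\bar{\mathcal N}_k^i$. Let $G_{ik}=(g_{ilk})_{l\in\bar{\mathcal N}_k^i}$ and $\bar G_{ik}=R_{ik}^TG_{ik}\in\mathbb R^{n_{ik}-1}$, where $R_{ik}$ is any $n_{ik}\times(n_{ik}-1)$ matrix such that $[\,\mathbf 1/\sqrt{n_{ik}}\ \ R_{ik}\,]$ is orthogonal. Let $\bar G_{-j}$ be the concatenation of the $\bar G_{ik}$ over $i\ne j$, $1\le k\le m_i$, and let $\chi_{-j}=(\bar G_{-j},\mathbf x-\mathbf x^*)$, with the Euclidean norm. Then there is a function $\phi\in\mathcal{KL}$ such that for each pair of positive constants $(\Delta,v)$ there is $\delta^*=\delta^*(\Delta,v)>0$ such that for each $\delta\in(0,\delta^*)$ and each initial action profile $\mathbf x(0)$ with $\|\chi_{-j}(0)\|<\Delta$, the seeking strategy has a solution on $[0,\infty)$ and every such solution satisfies $$\|\chi_{-j}(t)\|\le\phi(\|\chi_{-j}(0)\|,\delta t)+v\qquad\text{for all }t\ge 0 .$$ -/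

import Mathlib

open Set Filter Topology

namespace CoalitionGame

/-- The agents of the game: `⟨i, k⟩` is agent `k` of coalition `i`; coalition `i` has `m i` agents. -/
abbrev Agent {N : ℕ} (m : Fin N → ℕ) : Type := Σ i : Fin N, Fin (m i)

/-- Action profiles: one real action per agent, with the Euclidean norm. -/
abbrev Profile {N : ℕ} (m : Fin N → ℕ) : Type := EuclideanSpace ℝ (Agent m)

/-- The local objective functions: `f ⟨i, k⟩` is the objective of agent `k` of coalition `i`. -/
abbrev Objectives {N : ℕ} (m : Fin N → ℕ) : Type := Agent m → Profile m → ℝ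

/-- The partial derivative of `h` with respect to the action of agent `a`, at `x`. -/
noncomputable def partialDeriv {N : ℕ} {m : Fin N → ℕ} (h : Profile m → ℝ) (a : Agent m)
    (x : Profile m) : ℝ :=
  open Classical in fderiv ℝ h x (EuclideanSpace.single a (1 : ℝ))

/-- The cost of coalition `i`: the sum of the objectives of its agents. -/
noncomputable def coalitionCost {N : ℕ} {m : Fin N → ℕ} (f : Objectives m) (i : Fin N)
    (x : Profile m) : ℝ :=
  ∑ k : Fin (m i), f ⟨i, k⟩ x

/-- The pseudo-gradient: the partial gradients of the coalition costs with respect to the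
coalitions' own actions, stacked. -/
noncomputable def pseudoGradient {N : ℕ} {m : Fin N → ℕ} (f : Objectives m) (x : Profile m) :
    Profile m :=
  WithLp.toLp 2 fun a : Agent m => partialDeriv (coalitionCost f a.1) a x

/-- Pure-strategy Nash equilibrium of the game whose players are the coalitions. -/
def IsNashEquilibrium {N : ℕ} {m : Fin N → ℕ} (f : Objectives m) (xstar : Profile m) : Prop :=
  ∀ (i : Fin N) (y : Profile m), (∀ a : Agent m, a.1 ≠ i → y a = xstar a) →
    coalitionCost f i xstar ≤ coalitionCost f i y

/-- The function `h` depends explicitly on the action of agent `a`. -/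
def ExplicitlyDependsOn {N : ℕ} {m : Fin N → ℕ} (h : Profile m → ℝ) (a : Agent m) : Prop :=
  ∃ x y : Profile m, (∀ b : Agent m, b ≠ a → x b = y b) ∧ h x ≠ h y

/-- The interference graph of coalition `i`: two distinct agents are neighbours iff the objective
of one of them depends explicitly on the action of the other. -/
def interferenceGraph {N : ℕ} {m : Fin N → ℕ} (f : Objectives m) (i : Fin N) :
    SimpleGraph (Fin (m i)) where
  Adj k l := k ≠ l ∧
    (ExplicitlyDependsOn (f ⟨i, k⟩) ⟨i, l⟩ ∨ ExplicitlyDependsOn (f ⟨i, l⟩) ⟨i, k⟩)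
  symm := ⟨fun _ _ h => ⟨h.1.symm, h.2.symm⟩⟩
  loopless := ⟨fun _ h => h.1 rfl⟩

/-- For `p = ⟨i, k⟩`: agent `k` together with its neighbours in the interference graph of
coalition `i`. -/
noncomputable def closedNbhd {N : ℕ} {m : Fin N → ℕ} (f : Objectives m) (p : Agent m) :
    Finset (Fin (m p.1)) :=
  open Classical in
  Finset.univ.filter fun l => l = p.2 ∨ (interferenceGraph f p.1).Adj p.2 l

theorem self_mem_closedNbhd {N : ℕ} {m : Fin N → ℕ} (f : Objectives m) (p : Agent m) :
    p.2 ∈ closedNbhd f p := by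
  simp [closedNbhd]

/-- A simple weighted (possibly directed) graph, given by its adjacency matrix; there is an edge
from `v` to `u` iff `0 < weight u v`. -/
structure WeightedGraph (V : Type) where
  weight : V → V → ℝ
  weight_nonneg : ∀ u v, 0 ≤ weight u v
  weight_self : ∀ u, weight u u = 0

namespace WeightedGraph

/-- The graph is undirected. -/
def IsUndirected {V : Type} (G : WeightedGraph V) : Prop :=
  ∀ u v, G.weight u v = G.weight v u

/-- Every vertex can be reached from every other one along edges. -/
def IsConnected {V : Type} (G : WeightedGraph V) : Prop :=
  ∀ u v, Relation.ReflTransGen (fun a b => 0 < G.weight b a) u v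

/-- The graph that is left when the vertices outside `s` are removed. -/
def induce {V : Type} (G : WeightedGraph V) (s : Finset V) : WeightedGraph s where
  weight u v := G.weight u v
  weight_nonneg u v := G.weight_nonneg u v
  weight_self u := G.weight_self u

end WeightedGraph

/-- For `p = ⟨i, k⟩`: the interference-to-`k` communication graph of coalition `i`. -/
noncomputable def interferenceCommGraph {N : ℕ} {m : Fin N → ℕ} (f : Objectives m)
    (GC : ∀ i : Fin N, WeightedGraph (Fin (m i))) (p : Agent m) :
    WeightedGraph (closedNbhd f p) :=
  (GC p.1).induce (closedNbhd f p)

/-- The auxiliary variables: for `p = ⟨i, k⟩` and an agent `l` in the closed neighbourhood of `k`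
in the interference graph of coalition `i`, `w p l` is `w_{i l k}`. -/
abbrev AuxState {N : ℕ} {m : Fin N → ℕ} (f : Objectives m) : Type :=
  ∀ p : Agent m, closedNbhd f p → ℝ

/-- The estimates: for `p = ⟨i, k⟩`, `gradEst f x w p l` is
`g_{i l k} = w_{i l k} + ∂ f_{i l}(x) / ∂ x_{i k}`. -/
noncomputable def gradEst {N : ℕ} {m : Fin N → ℕ} (f : Objectives m) (x : Profile m)
    (w : AuxState f) (p : Agent m) (l : closedNbhd f p) : ℝ :=
  w p l + partialDeriv (f ⟨p.1, (l : Fin (m p.1))⟩) p x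

/-- `(x, w)` is generated on `[0, ∞)` by the seeking strategy with gains `δ * dbar p`. -/
structure IsTrajectory {N : ℕ} {m : Fin N → ℕ} (f : Objectives m)
    (GC : ∀ i : Fin N, WeightedGraph (Fin (m i))) (dbar : Agent m → ℝ) (δ : ℝ)
    (x : ℝ → Profile m) (w : ℝ → AuxState f) : Prop where
  aux_init : w 0 = 0
  action_deriv : ∀ t : ℝ, 0 ≤ t → ∀ p : Agent m,
    HasDerivWithinAt (fun s => x s p)
      (-(δ * dbar p * gradEst f (x t) (w t) p ⟨p.2, self_mem_closedNbhd f p⟩)) (Ici 0) t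
  aux_deriv : ∀ t : ℝ, 0 ≤ t → ∀ (p : Agent m) (l : closedNbhd f p),
    HasDerivWithinAt (fun s => w s p l)
      (-∑ l' : closedNbhd f p, (GC p.1).weight l l' *
        (gradEst f (x t) (w t) p l - gradEst f (x t) (w t) p l')) (Ici 0) t

/-- `R` completes the normalized all-ones column to an orthogonal matrix
`U = [1 / √n  R]` of size `n = s.card`. -/
def CompletesOnes {V : Type} [DecidableEq V] (s : Finset V)
    (R : Matrix s (Fin (s.card - 1)) ℝ) : Prop :=
  let U : Matrix s (Unit ⊕ Fin (s.card - 1)) ℝ :=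
    Matrix.fromCols (Matrix.of fun _ _ => 1 / Real.sqrt s.card) R
  U * U.transpose = 1 ∧ U.transpose * U = 1

/-- For `p = ⟨i, k⟩`: the disagreement vector `R_{ik}ᵀ G_{ik}`. -/
noncomputable def disagreement {N : ℕ} {m : Fin N → ℕ} (f : Objectives m)
    (R : ∀ p : Agent m, Matrix (closedNbhd f p) (Fin ((closedNbhd f p).card - 1)) ℝ)
    (x : Profile m) (w : AuxState f) (p : Agent m) : Fin ((closedNbhd f p).card - 1) → ℝ :=
  Matrix.mulVec (R p).transpose (gradEst f x w p)

/-- The reduced state: the disagreement vectors of all agents outside coalition `j`, stacked on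
the action error `x - xstar`; it carries the Euclidean norm. -/
noncomputable def reducedState {N : ℕ} {m : Fin N → ℕ} (f : Objectives m)
    (R : ∀ p : Agent m, Matrix (closedNbhd f p) (Fin ((closedNbhd f p).card - 1)) ℝ)
    (xstar : Profile m) (j : Fin N) (x : Profile m) (w : AuxState f) :
    EuclideanSpace ℝ
      ((Σ p : {p : Agent m // p.1 ≠ j}, Fin ((closedNbhd f p.1).card - 1)) ⊕ Agent m) :=
  WithLp.toLp 2 (Sum.elim (fun q => disagreement f R x w q.1.1 q.2) (fun a => x a - xstar a))

/-- Class KL functions (on the domain `[0, ∞) × [0, ∞)`). -/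
structure IsClassKL (φ : ℝ → ℝ → ℝ) : Prop where
  continuousOn : ContinuousOn (fun q : ℝ × ℝ => φ q.1 q.2) (Ici 0 ×ˢ Ici 0)
  zero_left : ∀ s, 0 ≤ s → φ 0 s = 0
  strictMonoOn : ∀ s, 0 ≤ s → StrictMonoOn (fun r => φ r s) (Ici 0)
  antitoneOn : ∀ r, 0 ≤ r → AntitoneOn (φ r) (Ici 0)
  tendsto_zero : ∀ r, 0 ≤ r → Tendsto (φ r) atTop (𝓝 0)

end CoalitionGame

/-! The dynamics have a fast and a slow part. The estimators of agent `p`'s gradient component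
average by a symmetric diffusion, so the auxiliary variables keep sum zero and the mean of the n_p
estimates is always exactly 1/n_p times the pseudo-gradient component. Only the deviations from the
means must be controlled.

Let W be the sum of the squared deviations and V the squared distance to x* with weights n_p/(2
d_p), d_p being the gains. While x stays in a ball, W' ≤ -λW + δ²C(1+W), with λ the smallest
spectral gap, because the actions move at speed O(δ). Moreover V' = -δD(x) + δ·O(√W) with D(x) = (x
- x*)·P(x); since P(x*) = 0, strict monotonicity makes D positive off x*.

Strict monotonicity gives no explicit rate, but it makes D nondecreasing along rays from x*, so its
minimum on a sphere bounds it outside: D ≥ 2a(v) > 0 where V ≥ v (`EstimateSystem.exists_rate`). For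
small δ, V + δcW then decreases at rate δa(v) while V exceeds v up to the tolerance, and a
continuity argument keeps x in the ball (`EstimateSystem.exists_practical_decay`). The resulting a
priori bound also gives global existence.

The bounds at all levels v merge into `decayProfile`, which depends only on the rate a; hence the KL
function does not depend on Δ, v or δ. W decays in t, so for δ < 1 also in δt, and adds an
exponential term.

The agent of the single-agent coalition has no disagreement, and an orthogonal completion of the
ones vector preserves the squared deviation, so the reduced state has squared norm W + ‖x - x*‖². -/

namespace CoalitionGame

/-! ### Scalar comparison and global existence for ODEs -/

/-- If `u` decreases at rate at least `d` whenever it is at least `c`, then it stays below the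
larger of `c` and the line of slope `-d` through its initial value. -/
theorem le_max_of_deriv_le {u u' : ℝ → ℝ} {T c d : ℝ} (hd : 0 < d)
    (hu : ∀ t ∈ Icc 0 T, HasDerivWithinAt u (u' t) (Ici 0) t)
    (h : ∀ t ∈ Icc 0 T, c ≤ u t → u' t ≤ -d) :
    ∀ t ∈ Icc 0 T, u t ≤ max c (u 0 - d * t) := by
  intro t ht
  have hcont : ContinuousOn u (Icc 0 T) := fun s hs =>
    ((hu s hs).mono Icc_subset_Ici_self).continuousWithinAt
  have hder : ∀ s ∈ Icc 0 T, HasDerivWithinAt u (u' s) (Ici s) s := fun s hs =>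
    (hu s hs).mono (Ici_subset_Ici.2 hs.1)
  -- Once `u` has reached level `c` it cannot cross it upwards; if it never does, the linear decay
  -- holds throughout.
  by_cases hex : ∃ s ∈ Icc 0 t, u s ≤ c
  · obtain ⟨s, hs, hsc⟩ := hex
    refine le_max_of_le_left ?_
    refine image_le_of_deriv_right_lt_deriv_boundary' (f := u) (f' := u') (a := s) (b := t)
      (B := fun _ => c) (B' := fun _ => 0)
      (hcont.mono (Icc_subset_Icc hs.1 ht.2)) (fun r hr => hder r ⟨hs.1.trans hr.1,
        hr.2.le.trans ht.2⟩) hsc continuousOn_const (fun r _ => hasDerivWithinAt_const _ _ _)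
      (fun r hr hrc => ?_) ⟨hs.2, le_rfl⟩
    have := h r ⟨hs.1.trans hr.1, hr.2.le.trans ht.2⟩ hrc.ge
    linarith
  · push Not at hex
    refine le_max_of_le_right ?_
    refine image_le_of_deriv_right_le_deriv_boundary (f := u) (f' := u') (a := 0) (b := t)
      (B := fun s => u 0 - d * s) (B' := fun _ => -d)
      (hcont.mono (Icc_subset_Icc le_rfl ht.2)) (fun r hr => hder r ⟨hr.1,
        hr.2.le.trans ht.2⟩) (by simp) (by fun_prop) (fun r _ => ?_)
      (fun r hr => ?_) ⟨ht.1, le_rfl⟩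
    · simpa using ((hasDerivWithinAt_id r (Ici r)).const_mul d).const_sub (u 0)
    · exact h r ⟨hr.1, hr.2.le.trans ht.2⟩ (hex r ⟨hr.1, hr.2.le⟩).le

/-- Integrating factor: exp(μs)(u s - k/μ) is nonincreasing. -/
theorem le_exp_mul_add_of_deriv_le {u u' : ℝ → ℝ} {T μ k : ℝ} (hμ : 0 < μ) (hk : 0 ≤ k)
    (hu : ∀ t ∈ Icc 0 T, HasDerivWithinAt u (u' t) (Ici 0) t)
    (h : ∀ t ∈ Icc 0 T, u' t ≤ -μ * u t + k) :
    ∀ t ∈ Icc 0 T, u t ≤ Real.exp (-μ * t) * u 0 + k / μ := by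
  intro t ht
  have key : ∀ s ∈ Icc 0 T, HasDerivWithinAt (fun s => Real.exp (μ * s) * (u s - k / μ))
      (Real.exp (μ * s) * μ * (u s - k / μ) + Real.exp (μ * s) * u' s) (Ici 0) s := by
    intro s hs
    have h1 : HasDerivAt (fun s => Real.exp (μ * s)) (Real.exp (μ * s) * μ) s := by
      simpa using ((hasDerivAt_id s).const_mul μ).exp
    exact h1.hasDerivWithinAt.mul ((hu s hs).sub_const _)
  have := image_le_of_deriv_right_le_deriv_boundary
    (f := fun s => Real.exp (μ * s) * (u s - k / μ))
    (f' := fun s => Real.exp (μ * s) * μ * (u s - k / μ) + Real.exp (μ * s) * u' s)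
    (a := 0) (b := T) (B := fun _ => u 0 - k / μ) (B' := fun _ => 0)
    (fun s hs => ((key s hs).mono Icc_subset_Ici_self).continuousWithinAt)
    (fun s hs => (key s ⟨hs.1, hs.2.le⟩).mono (Ici_subset_Ici.2 hs.1)) (by simp)
    continuousOn_const (fun r _ => hasDerivWithinAt_const _ _ _) (fun s hs => ?_) ht
  · have e : Real.exp (-μ * t) * Real.exp (μ * t) = 1 := by
      rw [← Real.exp_add]; simp
    have h2 := mul_le_mul_of_nonneg_left this (Real.exp_pos (-μ * t)).le
    rw [← mul_assoc, e, one_mul] at h2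
    have h3 : 0 ≤ Real.exp (-μ * t) * (k / μ) := by positivity
    nlinarith
  · have h1 := h s ⟨hs.1, hs.2.le⟩
    have h2 : μ * (u s - k / μ) + u' s ≤ 0 := by
      have : μ * (k / μ) = k := by field_simp
      nlinarith
    have := mul_nonpos_of_nonneg_of_nonpos (Real.exp_pos (μ * s)).le h2
    nlinarith

/-- A continuous function that starts below `c`, and is below `c` at every time up to which it does
not exceed `c`, stays below `c`. -/
theorem lt_of_forall_bootstrap {ψ : ℝ → ℝ} {c t : ℝ} (ht : 0 ≤ t) (hψ : ContinuousOn ψ (Icc 0 t))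
    (h0 : ψ 0 < c)
    (h : ∀ T ∈ Icc 0 t, (∀ s ∈ Icc 0 T, ψ s ≤ c) → ψ T < c) : ψ t < c := by
  by_contra! hc
  have hcl : IsCompact (Icc 0 t ∩ ψ ⁻¹' Ici c) :=
    isCompact_Icc.of_isClosed_subset (hψ.preimage_isClosed_of_isClosed isClosed_Icc isClosed_Ici)
      inter_subset_left
  obtain ⟨T, ⟨hT, hTc⟩, hleast⟩ := hcl.exists_isLeast ⟨t, ⟨ht, le_rfl⟩, hc⟩
  have hlt : ∀ s ∈ Ico 0 T, ψ s < c := by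
    intro s hs
    by_contra! hsc
    exact absurd (hleast ⟨⟨hs.1, hs.2.le.trans hT.2⟩, hsc⟩) (not_le.2 hs.2)
  -- The hypothesis at the first exit time `T` needs the bound at `T` itself; the intermediate value
  -- theorem excludes a jump above `c`.
  have hTle : ψ T ≤ c := by
    obtain ⟨s, hs, hsc⟩ := intermediate_value_Icc hT.1 (hψ.mono (Icc_subset_Icc_right hT.2))
      (show c ∈ Icc (ψ 0) (ψ T) from ⟨h0.le, hTc⟩)
    rcases hs.2.lt_or_eq with h' | rfl
    · exact absurd hsc (hlt s ⟨hs.1, h'⟩).ne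
    · exact hsc.le
  refine absurd (h T hT fun s hs => ?_) (not_lt.2 hTc)
  rcases hs.2.lt_or_eq with h' | rfl
  · exact (hlt s ⟨hs.1, h'⟩).le
  · exact hTle

/-- A bounded, globally Lipschitz vector field has forward solutions for all time. -/
theorem exists_forward_solution_of_lipschitz {E : Type*} [NormedAddCommGroup E] [NormedSpace ℝ E]
    [CompleteSpace E] {F : E → E} {K L : NNReal} (hK : LipschitzWith K F) (hL : ∀ x, ‖F x‖ ≤ L)
    (x₀ : E) :
    ∃ γ : ℝ → E, γ 0 = x₀ ∧ ∀ t, 0 ≤ t → HasDerivWithinAt γ (F (γ t)) (Ici 0) t := by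
  have hloc : ∀ n : ℕ, ∃ γ : ℝ → E, γ 0 = x₀ ∧
      ∀ t ∈ Icc (0 : ℝ) n, HasDerivWithinAt γ (F (γ t)) (Icc 0 n) t := by
    intro n
    -- Both bounds being global, the Picard ball may have radius `L * n`, which no curve of speed at
    -- most `L` leaves before time `n`.
    have hP : IsPicardLindelof (fun _ => F) (tmin := 0) (tmax := n)
        ⟨0, le_rfl, Nat.cast_nonneg n⟩ x₀ (L * n) 0 L K :=
      { lipschitzOnWith := fun _ _ => hK.lipschitzOnWith
        continuousOn := fun _ _ => continuousOn_const
        norm_le := fun _ _ x _ => hL x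
        mul_max_le := by simp }
    obtain ⟨γ, h0, h⟩ := hP.exists_eq_forall_mem_Icc_hasDerivWithinAt₀
    exact ⟨γ, h0, h⟩
  choose γ h0 hγ using hloc
  have hagree : ∀ n k : ℕ, n ≤ k → EqOn (γ n) (γ k) (Icc 0 n) := by
    intro n k hnk
    have hnk' : (n : ℝ) ≤ k := by exact_mod_cast hnk
    have hder : ∀ l : ℕ, (n : ℝ) ≤ l → ∀ t ∈ Ico (0 : ℝ) n,
        HasDerivWithinAt (γ l) (F (γ l t)) (Ici t) t := by
      intro l hl t ht
      have h1 := hγ l t ⟨ht.1, ht.2.le.trans hl⟩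
      have h2 : Icc t l ∈ 𝓝[Ici t] t := Icc_mem_nhdsGE (ht.2.trans_le hl)
      exact (h1.mono (Icc_subset_Icc_left ht.1)).mono_of_mem_nhdsWithin h2
    have hcont : ∀ l : ℕ, (n : ℝ) ≤ l → ContinuousOn (γ l) (Icc 0 n) := fun l hl t ht =>
      ((hγ l t ⟨ht.1, ht.2.trans hl⟩).mono (Icc_subset_Icc_right hl)).continuousWithinAt
    exact ODE_solution_unique_of_mem_Icc_right (v := fun _ => F) (s := fun _ => univ)
      (fun _ _ => hK.lipschitzOnWith) (hcont n le_rfl) (hder n le_rfl) (fun _ _ => mem_univ _)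
      (hcont k hnk') (hder k hnk') (fun _ _ => mem_univ _) ((h0 n).trans (h0 k).symm)
  have hval : ∀ (n : ℕ) (t : ℝ), t ∈ Icc (0 : ℝ) n → γ (⌈t⌉₊) t = γ n t := by
    intro n t ht
    exact hagree _ n (Nat.ceil_le.2 ht.2) ⟨ht.1, Nat.le_ceil t⟩
  refine ⟨fun t => γ (⌈t⌉₊) t, by simpa using h0 0, fun t ht => ?_⟩
  -- Strictly beyond `t`, so that [0, n] is a neighbourhood of `t` within [0, ∞), even when `t` is
  -- an integer.
  obtain ⟨n, hn⟩ := exists_nat_gt t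
  have h2 : Icc (0 : ℝ) n ∈ 𝓝[Ici 0] t := by
    rw [← Ici_inter_Iic]
    exact inter_mem self_mem_nhdsWithin (mem_nhdsWithin_of_mem_nhds (Iic_mem_nhds hn))
  have h3 := (hγ n t ⟨ht, hn.le⟩).mono_of_mem_nhdsWithin h2
  have h4 : (fun t => γ (⌈t⌉₊) t) =ᶠ[𝓝[Ici 0] t] γ n := by
    filter_upwards [h2] with s hs using hval n s hs
  rw [show F (γ (⌈t⌉₊) t) = F (γ n t) by rw [hval n t ⟨ht, hn.le⟩]]
  exact h3.congr_of_eventuallyEq h4 (hval n t ⟨ht, hn.le⟩)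

/-- Global forward existence for a `C¹` vector field from an a priori bound. -/
theorem exists_forward_solution_of_apriori_bound {E : Type*} [NormedAddCommGroup E]
    [NormedSpace ℝ E] [FiniteDimensional ℝ E] {F : E → E} (hF : ContDiff ℝ 1 F) (x₀ : E)
    {ρ : ℝ} (h0 : ‖x₀‖ < ρ)
    (hbound : ∀ (γ : ℝ → E) (T : ℝ), 0 ≤ T → γ 0 = x₀ →
      (∀ t ∈ Icc 0 T, HasDerivWithinAt γ (F (γ t)) (Ici 0) t) → ‖γ T‖ < ρ) :
    ∃ γ : ℝ → E, γ 0 = x₀ ∧ ∀ t, 0 ≤ t → HasDerivWithinAt γ (F (γ t)) (Ici 0) t := by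
  have hρ : 0 < ρ := (norm_nonneg _).trans_lt h0
  -- The cut-off field is bounded and Lipschitz and equals `F` on the ball of radius `ρ`, which the
  -- a priori bound keeps the solution from leaving.
  let b : ContDiffBump (0 : E) := ⟨ρ, ρ + 1, hρ, by linarith⟩
  have hsm : ContDiff ℝ 1 (fun x => b x • F x) := b.contDiff.smul hF
  have hcs : HasCompactSupport (fun x => b x • F x) := b.hasCompactSupport.smul_right
  obtain ⟨K, hK⟩ := ContDiff.lipschitzWith_of_hasCompactSupport hcs hsm one_ne_zero
  obtain ⟨C, hC⟩ := hcs.exists_bound_of_continuous hsm.continuous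
  have := FiniteDimensional.complete ℝ E
  obtain ⟨γ, hγ0, hγ⟩ := exists_forward_solution_of_lipschitz hK
    (L := C.toNNReal) (fun x => (hC x).trans (Real.le_coe_toNNReal C)) x₀
  have heq : ∀ x : E, ‖x‖ ≤ ρ → b x • F x = F x := by
    intro x hx
    rw [b.one_of_mem_closedBall (by simpa using hx), one_smul]
  have hlt : ∀ t, 0 ≤ t → ‖γ t‖ < ρ := by
    intro t ht
    refine lt_of_forall_bootstrap (ψ := fun t => ‖γ t‖) ht
      (fun s hs => ((hγ s hs.1).continuousWithinAt.mono Icc_subset_Ici_self).norm)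
      (by rw [hγ0]; exact h0) fun T hT hle => hbound γ T hT.1 hγ0 fun s hs => ?_
    rw [← heq _ (hle s hs)]
    exact hγ s hs.1
  refine ⟨γ, hγ0, fun t ht => ?_⟩
  rw [← heq _ (hlt t ht).le]
  exact hγ t ht

/-! ### A class KL function from a decay rate -/

/-- The decay profile of a quantity that starts at `r` and decreases at rate at least `a v` as long
as it exceeds `v`, for every level `v > 0`. -/
noncomputable def decayProfile (a : ℝ → ℝ) (r s : ℝ) : ℝ :=
  ⨅ v : Ioi (0 : ℝ), max (v : ℝ) (r - s * a v)

section decayProfile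

variable {a : ℝ → ℝ}

theorem decayProfile_bddBelow (a : ℝ → ℝ) (r s : ℝ) :
    BddBelow (range fun v : Ioi (0 : ℝ) => max (v : ℝ) (r - s * a v)) :=
  ⟨0, by rintro _ ⟨v, rfl⟩; exact le_max_of_le_left v.2.le⟩

theorem decayProfile_le (a : ℝ → ℝ) (r s : ℝ) {v : ℝ} (hv : 0 < v) :
    decayProfile a r s ≤ max v (r - s * a v) :=
  ciInf_le (decayProfile_bddBelow a r s) (⟨v, hv⟩ : Ioi (0 : ℝ))

theorem le_decayProfile {r s b : ℝ} (h : ∀ v, 0 < v → b ≤ max v (r - s * a v)) :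
    b ≤ decayProfile a r s :=
  have : Nonempty (Ioi (0 : ℝ)) := ⟨⟨1, mem_Ioi.2 one_pos⟩⟩
  le_ciInf fun v => h v v.2

theorem decayProfile_nonneg (a : ℝ → ℝ) (r s : ℝ) : 0 ≤ decayProfile a r s :=
  le_decayProfile fun _ hv => le_max_of_le_left hv.le

theorem decayProfile_zero_left (ha : ∀ v, 0 < v → 0 ≤ a v) {s : ℝ} (hs : 0 ≤ s) :
    decayProfile a 0 s = 0 := by
  refine le_antisymm (le_of_forall_pos_le_add fun ε hε => ?_) (decayProfile_nonneg a 0 s)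
  refine (decayProfile_le a 0 s hε).trans (max_le (by linarith) ?_)
  have := mul_nonneg hs (ha ε hε)
  linarith

theorem decayProfile_mono_left (a : ℝ → ℝ) {r r' : ℝ} (s : ℝ) (h : r ≤ r') :
    decayProfile a r s ≤ decayProfile a r' s :=
  le_decayProfile fun v hv => (decayProfile_le a r s hv).trans
    (max_le_max le_rfl (by linarith))

theorem decayProfile_anti_right (ha : ∀ v, 0 < v → 0 ≤ a v) (r : ℝ) {s s' : ℝ} (h : s ≤ s') :
    decayProfile a r s' ≤ decayProfile a r s :=
  le_decayProfile fun v hv => (decayProfile_le a r s' hv).trans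
    (max_le_max le_rfl (by have := mul_le_mul_of_nonneg_right h (ha v hv); linarith))

/-- As 0 ≤ a ≤ 1, every member of the infimum is 1-Lipschitz in `r` and in `s`, and so is the
infimum. No continuity of `a` is needed. -/
theorem decayProfile_le_add (ha : ∀ v, 0 < v → 0 ≤ a v) (ha1 : ∀ v, 0 < v → a v ≤ 1)
    (r s r' s' : ℝ) : decayProfile a r s ≤ decayProfile a r' s' + (|r - r'| + |s - s'|) := by
  rw [← sub_le_iff_le_add]
  refine le_decayProfile fun v hv => ?_
  rw [sub_le_iff_le_add]
  refine (decayProfile_le a r s hv).trans (max_le ?_ ?_)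
  · have := le_max_left v (r' - s' * a v)
    have := abs_nonneg (r - r')
    have := abs_nonneg (s - s')
    linarith
  · have h1 := le_max_right v (r' - s' * a v)
    have h2 := le_abs_self (r - r')
    have h3 : (s' - s) * a v ≤ |s - s'| * 1 := by
      rw [abs_sub_comm]
      exact mul_le_mul (le_abs_self _) (ha1 v hv) (ha v hv) (abs_nonneg _)
    linarith

theorem continuous_decayProfile (ha : ∀ v, 0 < v → 0 ≤ a v) (ha1 : ∀ v, 0 < v → a v ≤ 1) :
    Continuous fun q : ℝ × ℝ => decayProfile a q.1 q.2 := by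
  refine (LipschitzWith.of_dist_le_mul (K := 2) fun q q' => ?_).continuous
  have h1 := decayProfile_le_add ha ha1 q.1 q.2 q'.1 q'.2
  have h2 := decayProfile_le_add ha ha1 q'.1 q'.2 q.1 q.2
  rw [abs_sub_comm q'.1, abs_sub_comm q'.2] at h2
  have h3 : |q.1 - q'.1| ≤ dist q q' := le_max_left _ _
  have h4 : |q.2 - q'.2| ≤ dist q q' := le_max_right _ _
  rw [Real.dist_eq, abs_le]
  push_cast
  constructor <;> linarith

theorem tendsto_decayProfile (ha : ∀ v, 0 < v → 0 < a v) (r : ℝ) :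
    Tendsto (decayProfile a r) atTop (𝓝 0) := by
  rw [Metric.tendsto_atTop]
  intro ε hε
  have hε2 : 0 < ε / 2 := by linarith
  refine ⟨r / a (ε / 2), fun s hs => ?_⟩
  rw [Real.dist_eq, sub_zero, abs_of_nonneg (decayProfile_nonneg a r s)]
  refine (decayProfile_le a r s hε2).trans_lt (max_lt (by linarith) ?_)
  have := (div_le_iff₀ (ha _ hε2)).1 hs
  linarith

end decayProfile

/-- A class KL function built from a decay profile and an exponential. -/
theorem isClassKL_sqrt_decayProfile_add_exp {a : ℝ → ℝ} (ha : ∀ v, 0 < v → 0 < a v)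
    (ha1 : ∀ v, 0 < v → a v ≤ 1) {c k μ : ℝ} (hc : 0 ≤ c) (hk : 0 ≤ k) (hμ : 0 < μ) :
    IsClassKL fun r s =>
      Real.sqrt (c * decayProfile a (k * r ^ 2) s) + r * Real.exp (-μ * s) where
  continuousOn := by
    refine Continuous.continuousOn ?_
    have h := (continuous_decayProfile (fun v hv => (ha v hv).le) ha1).comp
      (show Continuous fun q : ℝ × ℝ => (k * q.1 ^ 2, q.2) by fun_prop)
    simp only [Function.comp_def] at h
    fun_prop
  zero_left s hs := by
    simp [decayProfile_zero_left (fun v hv => (ha v hv).le) hs]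
  -- The decay profile is only weakly increasing in `r`; strictness comes from the exponential term.
  strictMonoOn s _ := by
    intro r hr r' _ hrr'
    have hr0 : 0 ≤ r := hr
    refine add_lt_add_of_le_of_lt (Real.sqrt_le_sqrt (mul_le_mul_of_nonneg_left
      (decayProfile_mono_left a s ?_) hc)) (mul_lt_mul_of_pos_right hrr' (Real.exp_pos _))
    gcongr
  antitoneOn r hr := by
    intro s _ s' _ hss'
    have hr0 : 0 ≤ r := hr
    refine add_le_add (Real.sqrt_le_sqrt (mul_le_mul_of_nonneg_left
      (decayProfile_anti_right (fun v hv => (ha v hv).le) _ hss') hc))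
      (mul_le_mul_of_nonneg_left (Real.exp_le_exp.2 ?_) hr0)
    nlinarith
  tendsto_zero r _ := by
    have h1 := ((tendsto_decayProfile ha (k * r ^ 2)).const_mul c).sqrt
    have h2 : Tendsto (fun s => r * Real.exp (-μ * s)) atTop (𝓝 (r * 0)) :=
      (Real.tendsto_exp_atBot.comp
        (tendsto_id.const_mul_atTop_of_neg (neg_lt_zero.2 hμ))).const_mul r
    simpa using h1.add h2

/-! ### Mean and spread -/

/-- The mean of a finite family of reals. -/
noncomputable def mean {ι : Type*} [Fintype ι] (u : ι → ℝ) : ℝ := (∑ l, u l) / Fintype.card ι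

/-- The sum of squared deviations from the mean. -/
noncomputable def spread {ι : Type*} [Fintype ι] (u : ι → ℝ) : ℝ := ∑ l, (u l - mean u) ^ 2

theorem sum_sub_mean {ι : Type*} [Fintype ι] [Nonempty ι] (u : ι → ℝ) :
    ∑ l, (u l - mean u) = 0 := by
  have : (Fintype.card ι : ℝ) ≠ 0 := Nat.cast_ne_zero.2 Fintype.card_ne_zero
  rw [Finset.sum_sub_distrib, mean]
  simp
  field_simp
  ring

theorem spread_nonneg {ι : Type*} [Fintype ι] (u : ι → ℝ) : 0 ≤ spread u :=
  Finset.sum_nonneg fun _ _ => sq_nonneg _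

theorem sq_sub_mean_le_spread {ι : Type*} [Fintype ι] (u : ι → ℝ) (l : ι) :
    (u l - mean u) ^ 2 ≤ spread u :=
  Finset.single_le_sum (f := fun l => (u l - mean u) ^ 2) (fun _ _ => sq_nonneg _)
    (Finset.mem_univ l)

/-- The derivative of the mean drops out because the deviations sum to zero. -/
theorem hasDerivWithinAt_spread {ι : Type*} [Fintype ι] [Nonempty ι] {u : ℝ → ι → ℝ} {u' : ι → ℝ}
    {s : Set ℝ} {t : ℝ} (h : ∀ l, HasDerivWithinAt (fun r => u r l) (u' l) s t) :
    HasDerivWithinAt (fun r => spread (u r)) (2 * ∑ l, (u t l - mean (u t)) * u' l) s t := by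
  have hm : HasDerivWithinAt (fun r => mean (u r)) (mean u') s t :=
    (HasDerivWithinAt.fun_sum fun l _ => h l).div_const _
  have h1 : HasDerivWithinAt (fun r => spread (u r))
      (∑ l, 2 * (u t l - mean (u t)) * (u' l - mean u')) s t := by
    refine HasDerivWithinAt.fun_sum fun l _ => ?_
    simpa using ((h l).sub hm).fun_pow 2
  refine h1.congr_deriv ?_
  have h2 : ∑ l, 2 * (u t l - mean (u t)) * mean u' = 0 := by
    rw [← Finset.sum_mul, ← Finset.mul_sum, sum_sub_mean]; simp
  have h3 : ∀ l, 2 * (u t l - mean (u t)) * (u' l - mean u') =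
      2 * (u t l - mean (u t)) * u' l - 2 * (u t l - mean (u t)) * mean u' := fun l => by ring
  simp only [h3]
  rw [Finset.sum_sub_distrib, h2, sub_zero, Finset.mul_sum]
  exact Finset.sum_congr rfl fun _ _ => by ring

/-! ### The abstract seeking dynamics and their Lyapunov functions -/

/-- Agents `p : A`, each with a finite group `S p` of estimators of its own gradient component: the
estimators hold shares `share p l` whose sum is strictly monotone in the actions, and average them
by a linear diffusion with a spectral gap. -/
structure EstimateSystem (A : Type) [Fintype A] (S : A → Type) [∀ p, Fintype (S p)] where
  /-- The share of the gradient component of `p` that estimator `l` knows. -/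
  share : ∀ p, S p → EuclideanSpace ℝ A → ℝ
  /-- The coupling weights of the diffusion. -/
  coupling : ∀ p, S p → S p → ℝ
  /-- The estimator used by agent `p` itself. -/
  own : ∀ p, S p
  /-- The gains of the agents. -/
  gain : A → ℝ
  /-- The spectral gap of the diffusion. -/
  gap : ℝ
  /-- The rest point of the actions. -/
  center : EuclideanSpace ℝ A
  contDiff_share : ∀ p l, ContDiff ℝ 1 (share p l)
  coupling_symm : ∀ p l l', coupling p l l' = coupling p l' l
  gain_pos : ∀ p, 0 < gain p
  gap_pos : 0 < gap
  gap_le : ∀ p (e : S p → ℝ), ∑ l, e l = 0 →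
    gap * ∑ l, e l ^ 2 ≤ ∑ l, e l * ∑ l', coupling p l l' * (e l - e l')
  sum_share_center : ∀ p, ∑ l, share p l center = 0
  strictMono_sum_share : ∀ x y : EuclideanSpace ℝ A, x ≠ y →
    0 < ∑ p, (x p - y p) * (∑ l, share p l x - ∑ l, share p l y)

namespace EstimateSystem

variable {A : Type} [Fintype A] {S : A → Type} [∀ p, Fintype (S p)] (Z : EstimateSystem A S)

/-- The estimates of the gradient component of `p`. -/
def estimate (x : EuclideanSpace ℝ A) (w : ∀ p, S p → ℝ) (p : A) (l : S p) : ℝ :=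
  w p l + Z.share p l x

/-- The total disagreement of the estimates. -/
noncomputable def disagree (x : EuclideanSpace ℝ A) (w : ∀ p, S p → ℝ) : ℝ :=
  ∑ p, spread (Z.estimate x w p)

/-- The weight of agent `p` in the energy. -/
noncomputable def energyWeight (p : A) : ℝ := Fintype.card (S p) / Z.gain p

/-- The weighted squared distance to the rest point. -/
noncomputable def energy (x : EuclideanSpace ℝ A) : ℝ :=
  ∑ p, Z.energyWeight p * (x p - Z.center p) ^ 2 / 2

/-- The dissipation rate of the energy under the exact gradient play. -/
noncomputable def dissipation (x : EuclideanSpace ℝ A) : ℝ :=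
  ∑ p, (x p - Z.center p) * ∑ l, Z.share p l x

/-- `(x, w)` solves the seeking dynamics with parameter `δ` on `[0, T]`. -/
structure IsSolOn (δ T : ℝ) (x : ℝ → EuclideanSpace ℝ A) (w : ℝ → ∀ p, S p → ℝ) : Prop where
  aux_init : w 0 = 0
  action_deriv : ∀ t ∈ Icc 0 T, ∀ p, HasDerivWithinAt (fun s => x s p)
    (-(δ * Z.gain p * Z.estimate (x t) (w t) p (Z.own p))) (Ici 0) t
  aux_deriv : ∀ t ∈ Icc 0 T, ∀ p l, HasDerivWithinAt (fun s => w s p l)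
    (-∑ l', Z.coupling p l l' * (Z.estimate (x t) (w t) p l - Z.estimate (x t) (w t) p l'))
    (Ici 0) t

theorem card_pos (Z : EstimateSystem A S) (p : A) : (0 : ℝ) < Fintype.card (S p) :=
  have : Nonempty (S p) := ⟨Z.own p⟩
  Nat.cast_pos.2 Fintype.card_pos

theorem energyWeight_pos (p : A) : 0 < Z.energyWeight p := div_pos (Z.card_pos p) (Z.gain_pos p)

theorem disagree_nonneg (x : EuclideanSpace ℝ A) (w : ∀ p, S p → ℝ) : 0 ≤ Z.disagree x w :=
  Finset.sum_nonneg fun _ _ => spread_nonneg _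

theorem energy_nonneg (x : EuclideanSpace ℝ A) : 0 ≤ Z.energy x :=
  Finset.sum_nonneg fun p _ => by have := Z.energyWeight_pos p; positivity

theorem sq_norm_sub_center (x : EuclideanSpace ℝ A) :
    ‖x - Z.center‖ ^ 2 = ∑ p, (x p - Z.center p) ^ 2 := by
  simp [EuclideanSpace.norm_sq_eq]

theorem energy_le (x : EuclideanSpace ℝ A) :
    Z.energy x ≤ (∑ p, Z.energyWeight p) * ‖x - Z.center‖ ^ 2 := by
  rw [energy, Finset.sum_mul]
  refine Finset.sum_le_sum fun p _ => ?_
  have h1 : (x p - Z.center p) ^ 2 ≤ ‖x - Z.center‖ ^ 2 := by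
    rw [sq_norm_sub_center]
    exact Finset.single_le_sum (f := fun p => (x p - Z.center p) ^ 2) (fun _ _ => sq_nonneg _)
      (Finset.mem_univ p)
  have h2 := mul_le_mul_of_nonneg_left h1 (Z.energyWeight_pos p).le
  have h3 := mul_nonneg (Z.energyWeight_pos p).le (sq_nonneg (x p - Z.center p))
  linarith

theorem sq_norm_le_energy (x : EuclideanSpace ℝ A) :
    ‖x - Z.center‖ ^ 2 ≤ (∑ p, 2 / Z.energyWeight p) * Z.energy x := by
  rw [sq_norm_sub_center, Finset.sum_mul]
  refine Finset.sum_le_sum fun p _ => ?_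
  have h0 := Z.energyWeight_pos p
  have h1 : Z.energyWeight p * (x p - Z.center p) ^ 2 / 2 ≤ Z.energy x :=
    Finset.single_le_sum (f := fun p => Z.energyWeight p * (x p - Z.center p) ^ 2 / 2)
      (fun p _ => by have := Z.energyWeight_pos p; positivity) (Finset.mem_univ p)
  have h2 := mul_le_mul_of_nonneg_left h1 (div_pos two_pos h0).le
  refine le_trans (le_of_eq ?_) h2
  field_simp

variable {Z} {δ T : ℝ} {x : ℝ → EuclideanSpace ℝ A} {w : ℝ → ∀ p, S p → ℝ}

theorem IsSolOn.mono {T' : ℝ} (h : Z.IsSolOn δ T x w) (hT : T' ≤ T) : Z.IsSolOn δ T' x w where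
  aux_init := h.aux_init
  action_deriv t ht := h.action_deriv t ⟨ht.1, ht.2.trans hT⟩
  aux_deriv t ht := h.aux_deriv t ⟨ht.1, ht.2.trans hT⟩

/-- The auxiliary variables of each agent sum to zero. -/
theorem IsSolOn.sum_aux (h : Z.IsSolOn δ T x w) {t : ℝ} (ht : t ∈ Icc 0 T) (p : A) :
    ∑ l, w t p l = 0 := by
  have hder : ∀ s ∈ Icc 0 T, HasDerivWithinAt (fun s => ∑ l, w s p l) 0 (Ici 0) s := by
    intro s hs
    have h1 := HasDerivWithinAt.fun_sum (u := Finset.univ) fun l _ => h.aux_deriv s hs p l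
    refine h1.congr_deriv ?_
    rw [Finset.sum_neg_distrib, neg_eq_zero]
    set g := Z.estimate (x s) (w s) p
    -- Exchanging the indices turns the symmetric double sum into its own negative, so it vanishes.
    have h2 : ∑ l, ∑ l', Z.coupling p l l' * (g l - g l') =
        ∑ l, ∑ l', Z.coupling p l l' * (g l' - g l) := by
      rw [Finset.sum_comm]
      simp only [Z.coupling_symm p]
    have h3 : ∑ l, ∑ l', Z.coupling p l l' * (g l - g l') =
        -∑ l, ∑ l', Z.coupling p l l' * (g l' - g l) := by
      simp only [← Finset.sum_neg_distrib]
      exact Finset.sum_congr rfl fun l _ => Finset.sum_congr rfl fun l' _ => by ring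
    linarith
  have := constant_of_has_deriv_right_zero (f := fun s => ∑ l, w s p l) (a := 0) (b := T)
    (fun s hs => ((hder s hs).mono Icc_subset_Ici_self).continuousWithinAt)
    (fun s hs => (hder s ⟨hs.1, hs.2.le⟩).mono (Ici_subset_Ici.2 hs.1)) t ht
  rw [this, h.aux_init]
  simp

/-- The auxiliary variables keep sum zero, so the mean estimate follows the exact gradient component
without lag. -/
theorem IsSolOn.mean_estimate (h : Z.IsSolOn δ T x w) {t : ℝ} (ht : t ∈ Icc 0 T) (p : A) :
    mean (Z.estimate (x t) (w t) p) = (∑ l, Z.share p l (x t)) / Fintype.card (S p) := by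
  simp only [mean, estimate, Finset.sum_add_distrib, h.sum_aux ht, zero_add]

theorem IsSolOn.hasDerivWithinAt_action (h : Z.IsSolOn δ T x w) {t : ℝ} (ht : t ∈ Icc 0 T) :
    HasDerivWithinAt x (WithLp.toLp 2 fun p =>
      -(δ * Z.gain p * Z.estimate (x t) (w t) p (Z.own p))) (Ici 0) t := by
  rw [hasDerivWithinAt_iff_hasFDerivWithinAt, hasFDerivWithinAt_euclidean]
  intro p
  refine (h.action_deriv t ht p).hasFDerivWithinAt.congr_fderiv ?_
  ext
  simp

/-- Bounds on a ball for the shares and their derivatives. -/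
theorem exists_bound (Z : EstimateSystem A S) (K : ℝ) : ∃ B, 0 < B ∧ ∀ x, ‖x - Z.center‖ ≤ K →
    ∀ p l, |Z.share p l x| ≤ B ∧ ‖fderiv ℝ (Z.share p l) x‖ ≤ B := by
  have hK : IsCompact (Metric.closedBall Z.center K) := isCompact_closedBall _ _
  have h : ∀ q : Σ p, S p, ∃ B, 0 < B ∧ ∀ x, ‖x - Z.center‖ ≤ K →
      |Z.share q.1 q.2 x| ≤ B ∧ ‖fderiv ℝ (Z.share q.1 q.2) x‖ ≤ B := by
    intro q
    obtain ⟨B1, h1⟩ := hK.exists_bound_of_continuousOn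
      (Z.contDiff_share q.1 q.2).continuous.continuousOn
    obtain ⟨B2, h2⟩ := hK.exists_bound_of_continuousOn
      ((Z.contDiff_share q.1 q.2).continuous_fderiv one_ne_zero).continuousOn
    refine ⟨max 1 (max B1 B2), by positivity, fun x hx => ?_⟩
    have hx' : x ∈ Metric.closedBall Z.center K := by rwa [mem_closedBall_iff_norm]
    exact ⟨(h1 x hx').trans (by simp), (h2 x hx').trans (by simp)⟩
  choose B hB0 hB using h
  refine ⟨1 + ∑ q, B q, add_pos_of_pos_of_nonneg one_pos
    (Finset.sum_nonneg fun q _ => (hB0 q).le), fun x hx p l => ?_⟩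
  have hle : B ⟨p, l⟩ ≤ 1 + ∑ q, B q := by
    have := Finset.single_le_sum (f := B) (fun q _ => (hB0 q).le) (Finset.mem_univ ⟨p, l⟩)
    linarith
  exact ⟨(hB ⟨p, l⟩ x hx).1.trans hle, (hB ⟨p, l⟩ x hx).2.trans hle⟩

/-- The time derivative of the disagreement along a solution. -/
theorem IsSolOn.exists_hasDerivWithinAt_disagree (Z : EstimateSystem A S) (K : ℝ) :
    ∃ C, 0 < C ∧ ∀ {δ T : ℝ} {x : ℝ → EuclideanSpace ℝ A} {w : ℝ → ∀ p, S p → ℝ},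
      Z.IsSolOn δ T x w → ∀ t ∈ Icc 0 T, ‖x t - Z.center‖ ≤ K →
      ∃ D, HasDerivWithinAt (fun s => Z.disagree (x s) (w s)) D (Ici 0) t ∧
        D ≤ -Z.gap * Z.disagree (x t) (w t) + δ ^ 2 * C * (1 + Z.disagree (x t) (w t)) := by
  obtain ⟨B, hB0, hB⟩ := Z.exists_bound K
  set G : ℝ := ∑ p, Z.gain p ^ 2 with hG
  have hG0 : 0 ≤ G := Finset.sum_nonneg fun _ _ => sq_nonneg _
  set n : ℝ := ∑ p, (Fintype.card (S p) : ℝ) with hn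
  have hn0 : 0 ≤ n := Finset.sum_nonneg fun _ _ => Nat.cast_nonneg _
  have hgap := Z.gap_pos
  refine ⟨1 + n * B ^ 2 * G * (2 * B ^ 2 + 2) / Z.gap, by positivity, ?_⟩
  intro δ T x w h t ht hx
  set g := Z.estimate (x t) (w t) with hg
  set W := Z.disagree (x t) (w t) with hW
  have hW0 : 0 ≤ W := Z.disagree_nonneg _ _
  set xd : EuclideanSpace ℝ A := WithLp.toLp 2 fun p => -(δ * Z.gain p * g p (Z.own p)) with hxd
  set r : ∀ p, S p → ℝ := fun p l => fderiv ℝ (Z.share p l) (x t) xd with hr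
  have hne : ∀ p, Nonempty (S p) := fun p => ⟨Z.own p⟩
  have hderg : ∀ p l, HasDerivWithinAt (fun s => Z.estimate (x s) (w s) p l)
      (-∑ l', Z.coupling p l l' * (g p l - g p l') + r p l) (Ici 0) t := by
    intro p l
    refine (h.aux_deriv t ht p l).add ?_
    exact (((Z.contDiff_share p l).differentiable one_ne_zero).differentiableAt.hasFDerivAt
      (x := x t)).comp_hasDerivWithinAt t (h.hasDerivWithinAt_action ht)
  refine ⟨_, HasDerivWithinAt.fun_sum (u := Finset.univ) fun p _ =>
    hasDerivWithinAt_spread (hderg p), ?_⟩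
  have hspread : ∀ p, spread (g p) ≤ W := fun p =>
    Finset.single_le_sum (f := fun p => spread (g p)) (fun _ _ => spread_nonneg _)
      (Finset.mem_univ p)
  -- The own estimate is mean plus deviation: the mean is bounded by `B`, the squared deviation by
  -- `W`. This bounds the speed of the actions by O(δ).
  have hown : ∀ p, g p (Z.own p) ^ 2 ≤ (2 * B ^ 2 + 2) * (1 + W) := by
    intro p
    have h1 := (sq_sub_mean_le_spread (g p) (Z.own p)).trans (hspread p)
    have h2 : |mean (g p)| ≤ B := by
      rw [hg, h.mean_estimate ht, abs_div, abs_of_pos (Z.card_pos p), div_le_iff₀ (Z.card_pos p)]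
      refine (Finset.abs_sum_le_sum_abs _ _).trans ?_
      refine (Finset.sum_le_card_nsmul _ _ B fun l _ => (hB _ hx p l).1).trans ?_
      rw [nsmul_eq_mul, mul_comm, Finset.card_univ]
    have h3 : mean (g p) ^ 2 ≤ B ^ 2 := sq_le_sq' (abs_le.1 h2).1 (abs_le.1 h2).2
    have h4 : 0 ≤ B ^ 2 * W := by positivity
    nlinarith [sq_nonneg (g p (Z.own p) - mean (g p) - mean (g p))]
  have hxdn : ‖xd‖ ^ 2 ≤ δ ^ 2 * G * ((2 * B ^ 2 + 2) * (1 + W)) := by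
    rw [EuclideanSpace.norm_sq_eq, hG, Finset.mul_sum, Finset.sum_mul]
    refine Finset.sum_le_sum fun p _ => ?_
    rw [hxd, Real.norm_eq_abs, sq_abs, neg_sq, mul_pow, mul_pow]
    exact mul_le_mul_of_nonneg_left (hown p) (by positivity)
  have hrle : ∀ p l, r p l ^ 2 ≤ B ^ 2 * (δ ^ 2 * G * ((2 * B ^ 2 + 2) * (1 + W))) := by
    intro p l
    have h1 : |r p l| ≤ B * ‖xd‖ := by
      rw [← Real.norm_eq_abs]
      exact (ContinuousLinearMap.le_opNorm _ _).trans
        (mul_le_mul_of_nonneg_right (hB _ hx p l).2 (norm_nonneg _))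
    rw [← sq_abs]
    refine (pow_le_pow_left₀ (abs_nonneg _) h1 2).trans ?_
    rw [mul_pow]
    exact mul_le_mul_of_nonneg_left hxdn (sq_nonneg _)
  have hp : ∀ p, 2 * ∑ l, (g p l - mean (g p)) *
      (-∑ l', Z.coupling p l l' * (g p l - g p l') + r p l) ≤ -Z.gap * spread (g p) +
        Fintype.card (S p) * (B ^ 2 * (δ ^ 2 * G * ((2 * B ^ 2 + 2) * (1 + W)))) / Z.gap := by
    intro p
    -- The diffusion sees only differences, so it may be tested against the deviations, which sum to
    -- zero.
    have h1 := Z.gap_le p (fun l => g p l - mean (g p)) (sum_sub_mean (g p))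
    simp only [sub_sub_sub_cancel_right] at h1
    -- Young's inequality spends one of the two available multiples of `gap`; the remainder has
    -- order δ².
    have h2 : ∀ l, 2 * ((g p l - mean (g p)) * r p l) ≤ Z.gap * (g p l - mean (g p)) ^ 2 +
        B ^ 2 * (δ ^ 2 * G * ((2 * B ^ 2 + 2) * (1 + W))) / Z.gap := by
      intro l
      have h3 : r p l ^ 2 / Z.gap ≤ _ := div_le_div_of_nonneg_right (hrle p l) hgap.le
      have h4 : Z.gap * (g p l - mean (g p)) ^ 2 + r p l ^ 2 / Z.gap
          - 2 * ((g p l - mean (g p)) * r p l) =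
          (Z.gap * (g p l - mean (g p)) - r p l) ^ 2 / Z.gap := by field_simp; ring
      have h5 : 0 ≤ (Z.gap * (g p l - mean (g p)) - r p l) ^ 2 / Z.gap := by positivity
      linarith
    have h6 := Finset.sum_le_sum fun l (_ : l ∈ Finset.univ) => h2 l
    rw [Finset.sum_add_distrib, Finset.sum_const, ← Finset.mul_sum, ← Finset.mul_sum,
      nsmul_eq_mul, Finset.card_univ] at h6
    have h7 : ∑ l, (g p l - mean (g p)) *
        (-∑ l', Z.coupling p l l' * (g p l - g p l') + r p l) =
        -∑ l, (g p l - mean (g p)) * ∑ l', Z.coupling p l l' * (g p l - g p l') +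
        ∑ l, (g p l - mean (g p)) * r p l := by
      rw [← Finset.sum_neg_distrib, ← Finset.sum_add_distrib]
      exact Finset.sum_congr rfl fun l _ => by ring
    rw [h7, spread, mul_div_assoc]
    linarith
  refine (Finset.sum_le_sum fun p _ => hp p).trans ?_
  rw [Finset.sum_add_distrib, ← Finset.mul_sum, ← Finset.sum_div, ← Finset.sum_mul, ← hn]
  have h7 : ∑ p, spread (g p) = W := rfl
  rw [h7]
  have h8 : n * (B ^ 2 * (δ ^ 2 * G * ((2 * B ^ 2 + 2) * (1 + W)))) / Z.gap =
      δ ^ 2 * (n * B ^ 2 * G * (2 * B ^ 2 + 2) / Z.gap) * (1 + W) := by ring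
  rw [h8]
  have h9 : 0 ≤ δ ^ 2 * (1 + W) := by positivity
  nlinarith

/-- The time derivative of the energy along a solution. -/
theorem IsSolOn.exists_hasDerivWithinAt_energy (Z : EstimateSystem A S) (K : ℝ) :
    ∃ C, 0 < C ∧ ∀ {δ T : ℝ} {x : ℝ → EuclideanSpace ℝ A} {w : ℝ → ∀ p, S p → ℝ},
      Z.IsSolOn δ T x w → 0 < δ → ∀ t ∈ Icc 0 T, ‖x t - Z.center‖ ≤ K → ∀ ε > 0,
      ∃ D, HasDerivWithinAt (fun s => Z.energy (x s)) D (Ici 0) t ∧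
        D ≤ -δ * Z.dissipation (x t) +
          δ * (ε * C + Z.disagree (x t) (w t) / (4 * ε)) := by
  set n : ℝ := ∑ p, (Fintype.card (S p) : ℝ) ^ 2 with hn
  have hn0 : 0 ≤ n := Finset.sum_nonneg fun _ _ => sq_nonneg _
  refine ⟨1 + n * K ^ 2, by positivity, ?_⟩
  intro δ T x w h hδ t ht hx ε hε
  set g := Z.estimate (x t) (w t) with hg
  have hder : HasDerivWithinAt (fun s => Z.energy (x s))
      (∑ p, Z.energyWeight p * (2 * (x t p - Z.center p) *
        (-(δ * Z.gain p * g p (Z.own p)))) / 2) (Ici 0) t := by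
    refine HasDerivWithinAt.fun_sum fun p _ => HasDerivWithinAt.div_const
      (HasDerivWithinAt.const_mul _ ?_) _
    simpa using ((h.action_deriv t ht p).sub_const (Z.center p)).fun_pow 2
  refine ⟨_, hder, ?_⟩
  have hK : ∀ p, (x t p - Z.center p) ^ 2 ≤ K ^ 2 := by
    intro p
    have h1 : (x t p - Z.center p) ^ 2 ≤ ‖x t - Z.center‖ ^ 2 := by
      rw [sq_norm_sub_center]
      exact Finset.single_le_sum (f := fun p => (x t p - Z.center p) ^ 2)
        (fun _ _ => sq_nonneg _) (Finset.mem_univ p)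
    exact h1.trans (pow_le_pow_left₀ (norm_nonneg _) hx 2)
  have hp : ∀ p, Z.energyWeight p * (2 * (x t p - Z.center p) *
        (-(δ * Z.gain p * g p (Z.own p)))) / 2 ≤
      -δ * ((x t p - Z.center p) * ∑ l, Z.share p l (x t)) +
        δ * (ε * ((Fintype.card (S p) : ℝ) ^ 2 * K ^ 2) + spread (g p) / (4 * ε)) := by
    intro p
    have hc := Z.card_pos p
    have hgn := Z.gain_pos p
    have hm : ∑ l, Z.share p l (x t) = Fintype.card (S p) * mean (g p) := by
      rw [hg, h.mean_estimate ht]; field_simp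
    -- The weight n_p/gain_p cancels both the gain and the factor 1/n_p of the mean, leaving the
    -- exact dissipation plus a deviation term.
    have h1 : Z.energyWeight p * (2 * (x t p - Z.center p) *
        (-(δ * Z.gain p * g p (Z.own p)))) / 2 =
        -δ * ((x t p - Z.center p) * (Fintype.card (S p) * mean (g p))) +
        δ * (-(x t p - Z.center p) * Fintype.card (S p) * (g p (Z.own p) - mean (g p))) := by
      rw [energyWeight]; field_simp; ring
    rw [h1, hm]
    refine add_le_add le_rfl (mul_le_mul_of_nonneg_left ?_ hδ.le)
    have h2 := sq_sub_mean_le_spread (g p) (Z.own p)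
    have h3 := div_le_div_of_nonneg_right h2 (by positivity : 0 ≤ 4 * ε)
    have h4 : ε * ((Fintype.card (S p) : ℝ) ^ 2 * (x t p - Z.center p) ^ 2) ≤
        ε * ((Fintype.card (S p) : ℝ) ^ 2 * K ^ 2) :=
      mul_le_mul_of_nonneg_left (mul_le_mul_of_nonneg_left (hK p) (sq_nonneg _)) hε.le
    have h5 : ε * ((Fintype.card (S p) : ℝ) ^ 2 * (x t p - Z.center p) ^ 2) +
        (g p (Z.own p) - mean (g p)) ^ 2 / (4 * ε) -
        -(x t p - Z.center p) * Fintype.card (S p) * (g p (Z.own p) - mean (g p)) =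
        (2 * ε * (Fintype.card (S p) * (x t p - Z.center p)) +
          (g p (Z.own p) - mean (g p))) ^ 2 / (4 * ε) := by field_simp; ring
    have h6 : 0 ≤ (2 * ε * (Fintype.card (S p) * (x t p - Z.center p)) +
          (g p (Z.own p) - mean (g p))) ^ 2 / (4 * ε) := by positivity
    linarith
  refine (Finset.sum_le_sum fun p _ => hp p).trans ?_
  rw [Finset.sum_add_distrib, ← Finset.mul_sum, ← Finset.mul_sum, Finset.sum_add_distrib,
    ← Finset.mul_sum, ← Finset.sum_mul, ← Finset.sum_div, ← hn]
  refine add_le_add le_rfl (mul_le_mul_of_nonneg_left ?_ hδ.le)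
  refine add_le_add (mul_le_mul_of_nonneg_left (by linarith) hε.le) le_rfl

end EstimateSystem

/-! ### A uniform dissipation rate away from the rest point -/

namespace EstimateSystem

variable {A : Type} [Fintype A] {S : A → Type} [∀ p, Fintype (S p)]

theorem continuous_dissipation (Z : EstimateSystem A S) : Continuous Z.dissipation := by
  have h : ∀ p l, Continuous (Z.share p l) := fun p l => (Z.contDiff_share p l).continuous
  unfold dissipation
  fun_prop

theorem dissipation_pos (Z : EstimateSystem A S) {x : EuclideanSpace ℝ A} (hx : x ≠ Z.center) :
    0 < Z.dissipation x := by
  have h := Z.strictMono_sum_share x Z.center hx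
  simpa only [Z.sum_share_center, sub_zero, dissipation] using h

/-- The dissipation does not decrease along rays from the rest point. -/
theorem dissipation_le_of_ray (Z : EstimateSystem A S) (z : EuclideanSpace ℝ A) (hz : z ≠ 0)
    {s : ℝ} (hs0 : 0 < s) (hs1 : s ≤ 1) :
    Z.dissipation (Z.center + s • z) ≤ Z.dissipation (Z.center + z) := by
  rcases hs1.eq_or_lt with rfl | hs
  · simp
  have hne : Z.center + z ≠ Z.center + s • z := by
    intro h
    have h1 : (1 - s) • z = 0 := by
      rw [sub_smul, one_smul, sub_eq_zero]
      exact add_left_cancel h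
    exact (smul_ne_zero (sub_ne_zero.2 hs.ne') hz) h1
  have h1 := Z.strictMono_sum_share _ _ hne
  have h2 := Z.dissipation_pos (x := Z.center + s • z)
    (by simpa using ⟨hs0.ne', hz⟩)
  -- Monotonicity between the points at parameters 1 and s reads D(1) > D(s)/s, which is at least
  -- D(s).
  have h3 : ∑ p, ((Z.center + z) p - (Z.center + s • z) p) *
      (∑ l, Z.share p l (Z.center + z) - ∑ l, Z.share p l (Z.center + s • z)) =
      (1 - s) * (Z.dissipation (Z.center + z) - Z.dissipation (Z.center + s • z) / s) := by
    rw [dissipation, dissipation, Finset.sum_div, ← Finset.sum_sub_distrib, Finset.mul_sum]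
    refine Finset.sum_congr rfl fun p _ => ?_
    simp only [PiLp.add_apply, PiLp.smul_apply, smul_eq_mul]
    field_simp
    ring
  rw [h3] at h1
  have h4 := pos_of_mul_pos_right h1 (sub_pos.2 hs).le
  have h5 : Z.dissipation (Z.center + s • z) ≤ Z.dissipation (Z.center + s • z) / s := by
    rw [le_div_iff₀ hs0]
    nlinarith
  linarith

/-- High energy forces distance at least `r` from the rest point. Moving inwards along the ray to
the sphere of radius `r` does not increase the dissipation, and on this compact set it has a
positive minimum. -/
theorem exists_dissipation_lower_bound (Z : EstimateSystem A S) {v : ℝ} (hv : 0 < v) :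
    ∃ c, 0 < c ∧ ∀ x, v ≤ Z.energy x → c ≤ Z.dissipation x := by
  set k := ∑ p, Z.energyWeight p
  have hk : 0 ≤ k := Finset.sum_nonneg fun p _ => (Z.energyWeight_pos p).le
  set r := Real.sqrt (v / (k + 1)) with hr
  have hr0 : 0 < r := Real.sqrt_pos.2 (by positivity)
  have hfar : ∀ x, v ≤ Z.energy x → r ≤ ‖x - Z.center‖ := by
    intro x hx
    refine Real.sqrt_le_iff.2 ⟨norm_nonneg _, ?_⟩
    rw [div_le_iff₀ (by positivity)]
    have := Z.energy_le x
    nlinarith [sq_nonneg ‖x - Z.center‖]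
  have hmem : ∀ x, v ≤ Z.energy x → ∃ y ∈ Metric.sphere Z.center r,
      Z.dissipation y ≤ Z.dissipation x := by
    intro x hx
    have hrx := hfar x hx
    have hpos : 0 < ‖x - Z.center‖ := hr0.trans_le hrx
    refine ⟨Z.center + (r / ‖x - Z.center‖) • (x - Z.center), ?_, ?_⟩
    · rw [mem_sphere_iff_norm, add_sub_cancel_left, norm_smul, Real.norm_eq_abs,
        abs_of_pos (by positivity)]
      field_simp
    · have := Z.dissipation_le_of_ray (x - Z.center) (norm_pos_iff.1 hpos)
        (s := r / ‖x - Z.center‖) (by positivity) ((div_le_one hpos).2 hrx)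
      simpa using this
  by_cases hne : (Metric.sphere Z.center r).Nonempty
  · obtain ⟨y, hy, hmin⟩ := (isCompact_sphere Z.center r).exists_isMinOn hne
      Z.continuous_dissipation.continuousOn
    refine ⟨Z.dissipation y, Z.dissipation_pos ?_, fun x hx => ?_⟩
    · rintro rfl
      simp [hr0.ne] at hy
    · obtain ⟨y', hy', hle⟩ := hmem x hx
      exact (hmin hy').trans hle
  · refine ⟨1, one_pos, fun x hx => ?_⟩
    obtain ⟨y', hy', _⟩ := hmem x hx
    exact absurd ⟨y', hy'⟩ hne

/-- A monotone lower bound for the dissipation in terms of the energy. -/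
theorem exists_rate (Z : EstimateSystem A S) : ∃ a : ℝ → ℝ, (∀ v, 0 < v → 0 < a v) ∧
    (∀ v, 0 < v → a v ≤ 1) ∧ (∀ v v', 0 < v → v ≤ v' → a v ≤ a v') ∧
    ∀ v, 0 < v → ∀ x, v ≤ Z.energy x → 2 * a v ≤ Z.dissipation x := by
  -- These sets grow with `v`, so their suprema are monotone. The cap 1 makes the decay profile
  -- Lipschitz; the factor 2 leaves half of the dissipation to absorb errors.
  let B : ℝ → Set ℝ := fun v => {b | b ≤ 1 ∧ ∀ x, v ≤ Z.energy x → 2 * b ≤ Z.dissipation x}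
  have hbdd : ∀ v, BddAbove (B v) := fun v => ⟨1, fun b hb => hb.1⟩
  have hex : ∀ v, 0 < v → ∃ b ∈ B v, 0 < b := by
    intro v hv
    obtain ⟨c, hc, h⟩ := Z.exists_dissipation_lower_bound hv
    refine ⟨min 1 (c / 2), ⟨min_le_left _ _, fun x hx => ?_⟩, by positivity⟩
    have := min_le_right 1 (c / 2)
    linarith [h x hx]
  refine ⟨fun v => sSup (B v), fun v hv => ?_, fun v hv => ?_, fun v v' hv hvv => ?_,
    fun v hv x hx => ?_⟩
  · obtain ⟨b, hb, hb0⟩ := hex v hv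
    exact hb0.trans_le (le_csSup (hbdd v) hb)
  · obtain ⟨b, hb, -⟩ := hex v hv
    exact csSup_le ⟨b, hb⟩ fun b hb => hb.1
  · obtain ⟨b, hb, -⟩ := hex v hv
    exact csSup_le_csSup (hbdd v') ⟨b, hb⟩ fun b hb => ⟨hb.1, fun x hx => hb.2 x (hvv.trans hx)⟩
  · obtain ⟨b, hb, -⟩ := hex v hv
    have : sSup (B v) ≤ Z.dissipation x / 2 :=
      csSup_le ⟨b, hb⟩ fun b hb => by linarith [hb.2 x hx]
    linarith

/-! ### Practical decay for small δ -/

/-- Practical decay of the energy and of the disagreement, for small `δ`. -/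
theorem exists_practical_decay (Z : EstimateSystem A S) {a : ℝ → ℝ}
    (ha : ∀ v, 0 < v → 0 < a v) (hmono : ∀ v v', 0 < v → v ≤ v' → a v ≤ a v')
    (hdiss : ∀ v, 0 < v → ∀ x, v ≤ Z.energy x → 2 * a v ≤ Z.dissipation x)
    {Δ v : ℝ} (hv : 0 < v) :
    ∃ δstar > 0, ∀ δ, 0 < δ → δ < δstar → ∀ {T : ℝ} {x : ℝ → EuclideanSpace ℝ A}
      {w : ℝ → ∀ p, S p → ℝ}, Z.IsSolOn δ T x w →
      ‖x 0 - Z.center‖ ≤ Δ → Z.disagree (x 0) (w 0) ≤ Δ ^ 2 → ∀ t ∈ Icc 0 T,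
        Z.energy (x t) ≤ decayProfile a (Z.energy (x 0)) (δ * t) + v ∧
        Z.disagree (x t) (w t) ≤
          Real.exp (-(Z.gap / 2) * t) * Z.disagree (x 0) (w 0) + v := by
  have hgap := Z.gap_pos
  set k := ∑ p, Z.energyWeight p with hk
  have hk0 : 0 ≤ k := Finset.sum_nonneg fun p _ => (Z.energyWeight_pos p).le
  -- Energy barrier for the bootstrap: the estimates yield at most k Δ² + v, strictly below `M`. `K`
  -- is the radius of the corresponding ball.
  set M := k * Δ ^ 2 + v + 1 with hM
  set K := Real.sqrt ((∑ p, 2 / Z.energyWeight p) * M) with hK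
  obtain ⟨C₁, hC₁, hdis⟩ := IsSolOn.exists_hasDerivWithinAt_disagree Z K
  obtain ⟨C₂, hC₂, hen⟩ := IsSolOn.exists_hasDerivWithinAt_energy Z K
  have hv2 : 0 < v / 2 := by linarith
  set a₀ := a (v / 2) with ha₀
  have ha0 : 0 < a₀ := ha _ hv2
  -- With this `ε` the Young error in V' is a₀/4, and `c` is such that c·gap/2 = 1/(4ε): the decay
  -- of δcW cancels the W term of V'.
  set ε := a₀ / (4 * C₂) with hε
  have hε0 : 0 < ε := by positivity
  set c := 1 / (2 * ε * Z.gap) with hc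
  have hc0 : 0 < c := by positivity
  -- The bounds give, in order: δ² ≤ δ; δ²C₁W absorbed by half the gap; residual disagreement at
  -- most min v 1; δcW ≤ v/2; and cδ²C₁ ≤ a₀/4.
  refine ⟨min 1 (min (Z.gap / (2 * C₁)) (min (min v 1 * Z.gap / (2 * C₁))
    (min (v / 2 / (c * (Δ ^ 2 + 1))) (a₀ / 4 / (c * C₁))))), by positivity, ?_⟩
  intro δ hδ hδs T x w hsol hx0 hW0 t ht
  simp only [lt_min_iff] at hδs
  obtain ⟨hδ1, hδ2, hδ3, hδ4, hδ5⟩ := hδs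
  have hδsq : δ ^ 2 ≤ δ := by nlinarith
  have hδC : δ ^ 2 * C₁ ≤ δ * C₁ := mul_le_mul_of_nonneg_right hδsq hC₁.le
  rw [lt_div_iff₀ (by positivity)] at hδ2 hδ3 hδ4 hδ5
  have hT : 0 ≤ T := ht.1.trans ht.2
  have hV0 : Z.energy (x 0) ≤ k * Δ ^ 2 := (Z.energy_le _).trans
    (mul_le_mul_of_nonneg_left (pow_le_pow_left₀ (norm_nonneg _) hx0 2) hk0)
  have hWnn : ∀ s, 0 ≤ Z.disagree (x s) (w s) := fun s => Z.disagree_nonneg _ _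
  have key : ∀ T' ∈ Icc 0 T, (∀ s ∈ Icc 0 T', Z.energy (x s) ≤ M) → ∀ s ∈ Icc 0 T',
      (∀ v' ≥ v / 2, Z.energy (x s) ≤
        max v' (Z.energy (x 0) - δ * s * a v') + v / 2) ∧
      Z.disagree (x s) (w s) ≤
        Real.exp (-(Z.gap / 2) * s) * Z.disagree (x 0) (w 0) + min v 1 := by
    intro T' hT' hle
    have hball : ∀ s ∈ Icc 0 T', ‖x s - Z.center‖ ≤ K := by
      intro s hs
      refine Real.le_sqrt_of_sq_le ((Z.sq_norm_le_energy _).trans ?_)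
      refine mul_le_mul_of_nonneg_left (hle s hs) (Finset.sum_nonneg fun p _ => ?_)
      exact (div_pos two_pos (Z.energyWeight_pos p)).le
    have hud : ∀ s ∈ Icc 0 T', UniqueDiffWithinAt ℝ (Ici (0 : ℝ)) s := fun s hs =>
      uniqueDiffOn_Ici 0 s hs.1
    set W := fun s => Z.disagree (x s) (w s) with hWdef
    set V := fun s => Z.energy (x s) with hVdef
    have hWd : ∀ s ∈ Icc 0 T', HasDerivWithinAt W (derivWithin W (Ici 0) s) (Ici 0) s ∧
        derivWithin W (Ici 0) s ≤ -(Z.gap / 2) * W s + δ ^ 2 * C₁ := by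
      intro s hs
      obtain ⟨D, hD, hDle⟩ := hdis (hsol.mono hT'.2) s hs (hball s hs)
      rw [hD.derivWithin (hud s hs)]
      refine ⟨hD, hDle.trans ?_⟩
      have h1 : δ ^ 2 * C₁ * W s ≤ Z.gap / 2 * W s :=
        mul_le_mul_of_nonneg_right (by linarith) (hWnn s)
      simp only [hWdef] at h1 ⊢
      linarith
    have hVd : ∀ s ∈ Icc 0 T', HasDerivWithinAt V (derivWithin V (Ici 0) s) (Ici 0) s ∧
        derivWithin V (Ici 0) s ≤
          -δ * Z.dissipation (x s) + δ * (ε * C₂ + W s / (4 * ε)) := by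
      intro s hs
      obtain ⟨D, hD, hDle⟩ := hen (hsol.mono hT'.2) hδ s hs (hball s hs) ε hε0
      rw [hD.derivWithin (hud s hs)]
      exact ⟨hD, hDle⟩
    have hWle : ∀ s ∈ Icc 0 T', W s ≤ Real.exp (-(Z.gap / 2) * s) * W 0 + min v 1 := by
      intro s hs
      refine (le_exp_mul_add_of_deriv_le (half_pos hgap) (k := δ ^ 2 * C₁) (by positivity)
        (fun r hr => (hWd r hr).1) (fun r hr => (hWd r hr).2) s hs).trans ?_
      refine add_le_add le_rfl ?_
      rw [div_le_iff₀ (by positivity)]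
      linarith
    have hWle' : ∀ s ∈ Icc 0 T', δ * c * W s ≤ v / 2 := by
      intro s hs
      have h1 : Real.exp (-(Z.gap / 2) * s) ≤ 1 := by
        rw [Real.exp_le_one_iff]
        nlinarith [hs.1]
      have h2 := mul_le_mul h1 hW0 (hWnn 0) zero_le_one
      have h3 := hWle s hs
      have h4 := min_le_right v 1
      have h5 : W s ≤ Δ ^ 2 + 1 := by simp only [hWdef] at h3 ⊢; linarith
      have h6 := mul_le_mul_of_nonneg_left h5 (mul_pos hδ hc0).le
      linarith
    intro s hs
    refine ⟨fun v' hv' => ?_, hWle s hs⟩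
    have hv'0 : 0 < v' := hv2.trans_le hv'
    -- Since δcW ≤ v/2, the sum can exceed v' + v/2 only when V ≥ v'. There the dissipation is at
    -- least 2 a(v') and the errors total a₀/2 ≤ a(v'), all times δ.
    have hU := le_max_of_deriv_le (u := fun s => V s + δ * c * W s)
      (u' := fun s => derivWithin V (Ici 0) s + δ * c * derivWithin W (Ici 0) s)
      (T := T') (c := v' + v / 2) (d := δ * a v') (mul_pos hδ (ha v' hv'0))
      (fun r hr => (hVd r hr).1.add ((hWd r hr).1.const_mul _)) (fun r hr hcr => ?_) s hs
    · have h1 := hWle' 0 ⟨le_rfl, hT'.1⟩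
      have h2 : 0 ≤ δ * c * W s := mul_nonneg (mul_pos hδ hc0).le (hWnn s)
      have h3 : max (v' + v / 2) (V 0 + δ * c * W 0 - δ * a v' * s) ≤
          max v' (V 0 - δ * s * a v') + v / 2 := by
        refine max_le (add_le_add (le_max_left _ _) le_rfl) ?_
        have := le_max_right v' (V 0 - δ * s * a v')
        linarith
      have h4 := hU.trans h3
      have h5 : V s ≤ V s + δ * c * W s := by linarith
      exact h5.trans h4
    · have h1 := hWle' r hr
      have h2 : v' ≤ Z.energy (x r) := by
        simp only [hVdef] at hcr
        linarith
      have h3 := hdiss v' hv'0 _ h2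
      have h4 := (hVd r hr).2
      have h5 := mul_le_mul_of_nonneg_left (hWd r hr).2 (mul_pos hδ hc0).le
      have h6 : δ * c * (-(Z.gap / 2) * W r + δ ^ 2 * C₁) =
          -(δ * (W r / (4 * ε))) + δ * (c * (δ ^ 2 * C₁)) := by
        rw [hc]; field_simp; ring
      have h7 : δ * (c * (δ ^ 2 * C₁)) ≤ δ * (a₀ / 4) := by
        refine mul_le_mul_of_nonneg_left ?_ hδ.le
        have := mul_le_mul_of_nonneg_left hδC hc0.le
        linarith
      have h8 : ε * C₂ = a₀ / 4 := by rw [hε]; field_simp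
      have h9 := mul_le_mul_of_nonneg_left h3 hδ.le
      have h10 := mul_le_mul_of_nonneg_left (hmono (v / 2) v' hv2 hv') hδ.le
      have h11 : 0 < δ * a₀ := mul_pos hδ ha0
      rw [h6] at h5
      rw [h8] at h4
      have h12 : δ * (a₀ / 4 + W r / (4 * ε)) = δ * (a₀ / 4) + δ * (W r / (4 * ε)) := by ring
      rw [h12] at h4
      simp only [← ha₀] at h10
      linarith
  have hVcont : ContinuousOn (fun s => Z.energy (x s)) (Icc 0 T) := by
    have h2 : ∀ p, ContinuousOn (fun s => x s p) (Icc 0 T) := fun p s hs =>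
      ((hsol.action_deriv s hs p).mono Icc_subset_Ici_self).continuousWithinAt
    unfold energy
    fun_prop
  have hlt : ∀ s ∈ Icc 0 T, Z.energy (x s) < M := by
    intro s hs
    refine lt_of_forall_bootstrap (ψ := fun s => Z.energy (x s)) hs.1
      (hVcont.mono (Icc_subset_Icc_right hs.2)) (by linarith) fun T' hT' hle => ?_
    have hT'' : T' ∈ Icc 0 T := ⟨hT'.1, hT'.2.trans hs.2⟩
    have h1 := (key T' hT'' hle T' ⟨hT'.1, le_rfl⟩).1 (v / 2) le_rfl
    have h2 : 0 ≤ δ * T' * a (v / 2) := mul_nonneg (mul_nonneg hδ.le hT'.1) (ha _ hv2).le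
    have h3 : max (v / 2) (Z.energy (x 0) - δ * T' * a (v / 2)) ≤ v / 2 + k * Δ ^ 2 :=
      max_le (by nlinarith [sq_nonneg Δ]) (by linarith)
    linarith
  obtain ⟨h1, h2⟩ := key T ⟨hT, le_rfl⟩ (fun s hs => (hlt s hs).le) t ht
  refine ⟨?_, h2.trans (add_le_add le_rfl (min_le_left _ _))⟩
  rw [← sub_le_iff_le_add]
  refine le_decayProfile fun v' hv' => ?_
  -- Levels below v/2 are compared with v/2 itself: `a` is monotone, and the loss is at most v/2.
  rcases le_total (v / 2) v' with h | h
  · have := h1 v' h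
    linarith
  · have h3 := h1 (v / 2) le_rfl
    have h4 : max (v / 2) (Z.energy (x 0) - δ * t * a (v / 2)) ≤
        max v' (Z.energy (x 0) - δ * t * a v') + v / 2 := by
      refine max_le ?_ ?_
      · have := le_max_left v' (Z.energy (x 0) - δ * t * a v')
        linarith
      · have := le_max_right v' (Z.energy (x 0) - δ * t * a v')
        have h5 := mul_le_mul_of_nonneg_left (hmono v' (v / 2) hv' h) (mul_nonneg hδ.le ht.1)
        linarith
    linarith

/-! ### Global existence -/

/-- The vector field of the seeking dynamics. -/
noncomputable def field (Z : EstimateSystem A S) (δ : ℝ)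
    (y : EuclideanSpace ℝ A × (∀ p, S p → ℝ)) : EuclideanSpace ℝ A × (∀ p, S p → ℝ) :=
  (WithLp.toLp 2 fun p => -(δ * Z.gain p * Z.estimate y.1 y.2 p (Z.own p)),
    fun p l => -∑ l', Z.coupling p l l' * (Z.estimate y.1 y.2 p l - Z.estimate y.1 y.2 p l'))

theorem contDiff_field (Z : EstimateSystem A S) (δ : ℝ) : ContDiff ℝ 1 (Z.field δ) := by
  have h : ∀ p l, ContDiff ℝ 1 fun y : EuclideanSpace ℝ A × (∀ p, S p → ℝ) =>
      Z.estimate y.1 y.2 p l := by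
    intro p l
    exact (contDiff_pi.1 (contDiff_pi.1 contDiff_snd p) l).add
      ((Z.contDiff_share p l).comp contDiff_fst)
  refine ContDiff.prodMk (contDiff_euclidean.2 fun p => ?_) (contDiff_pi.2 fun p =>
    contDiff_pi.2 fun l => ?_)
  · exact (contDiff_const.mul (h p (Z.own p))).neg
  · exact (ContDiff.sum fun l' _ => contDiff_const.mul ((h p l).sub (h p l'))).neg

theorem isSolOn_of_hasDerivWithinAt (Z : EstimateSystem A S) {δ T : ℝ}
    {γ : ℝ → EuclideanSpace ℝ A × (∀ p, S p → ℝ)} (h0 : (γ 0).2 = 0)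
    (h : ∀ t ∈ Icc 0 T, HasDerivWithinAt γ (Z.field δ (γ t)) (Ici 0) t) :
    Z.IsSolOn δ T (fun t => (γ t).1) (fun t => (γ t).2) where
  aux_init := h0
  action_deriv t ht p := by
    have h1 : HasDerivWithinAt (fun t => (γ t).1) _ (Ici 0) t :=
      ((ContinuousLinearMap.fst ℝ (EuclideanSpace ℝ A)
        (∀ p, S p → ℝ)).hasFDerivAt.comp_hasDerivWithinAt t (h t ht))
    exact (EuclideanSpace.proj (𝕜 := ℝ) p).hasFDerivAt.comp_hasDerivWithinAt t h1
  aux_deriv t ht p l := by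
    have h1 : HasDerivWithinAt (fun t => (γ t).2) _ (Ici 0) t :=
      ((ContinuousLinearMap.snd ℝ (EuclideanSpace ℝ A)
        (∀ p, S p → ℝ)).hasFDerivAt.comp_hasDerivWithinAt t (h t ht))
    exact hasDerivWithinAt_pi.1 (hasDerivWithinAt_pi.1 h1 p) l

/-- Solutions whose energy and disagreement are bounded are bounded. -/
theorem exists_norm_lt (Z : EstimateSystem A S) (M : ℝ) : ∃ ρ, ∀ {δ T : ℝ}
    {x : ℝ → EuclideanSpace ℝ A} {w : ℝ → ∀ p, S p → ℝ}, Z.IsSolOn δ T x w → ∀ t ∈ Icc 0 T,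
    Z.energy (x t) ≤ M → Z.disagree (x t) (w t) ≤ M → ‖(x t, w t)‖ < ρ := by
  set K := Real.sqrt ((∑ p, 2 / Z.energyWeight p) * M) with hK
  obtain ⟨B, hB0, hB⟩ := Z.exists_bound K
  have hK0 : 0 ≤ K := Real.sqrt_nonneg _
  refine ⟨K + ‖Z.center‖ + (Real.sqrt M + 2 * B) + 1, ?_⟩
  intro δ T x w h t ht hV hW
  have hball : ‖x t - Z.center‖ ≤ K := by
    refine Real.le_sqrt_of_sq_le ((Z.sq_norm_le_energy _).trans ?_)
    refine mul_le_mul_of_nonneg_left hV (Finset.sum_nonneg fun p _ => ?_)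
    exact (div_pos two_pos (Z.energyWeight_pos p)).le
  have hx : ‖x t‖ ≤ K + ‖Z.center‖ := by
    have := norm_add_le (x t - Z.center) Z.center
    rw [sub_add_cancel] at this
    linarith
  have hM0 : 0 ≤ Real.sqrt M := Real.sqrt_nonneg _
  have hw : ‖w t‖ ≤ Real.sqrt M + 2 * B := by
    refine (pi_norm_le_iff_of_nonneg (by positivity)).2 fun p =>
      (pi_norm_le_iff_of_nonneg (by positivity)).2 fun l => ?_
    -- An auxiliary variable is deviation plus mean minus share, bounded by √M, B and B.
    have h1 : |Z.estimate (x t) (w t) p l - mean (Z.estimate (x t) (w t) p)| ≤ Real.sqrt M := by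
      refine Real.abs_le_sqrt ((sq_sub_mean_le_spread _ l).trans (le_trans ?_ hW))
      exact Finset.single_le_sum (f := fun p => spread (Z.estimate (x t) (w t) p))
        (fun _ _ => spread_nonneg _) (Finset.mem_univ p)
    have h2 : |mean (Z.estimate (x t) (w t) p)| ≤ B := by
      rw [h.mean_estimate ht, abs_div, abs_of_pos (Z.card_pos p), div_le_iff₀ (Z.card_pos p)]
      refine (Finset.abs_sum_le_sum_abs _ _).trans ?_
      refine (Finset.sum_le_card_nsmul _ _ B fun l _ => (hB _ hball p l).1).trans ?_
      rw [nsmul_eq_mul, mul_comm, Finset.card_univ]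
    have h3 := (hB _ hball p l).1
    have h4 : Z.estimate (x t) (w t) p l = w t p l + Z.share p l (x t) := rfl
    rw [Real.norm_eq_abs]
    rw [h4] at h1
    rw [abs_le] at *
    constructor <;> linarith [h1.1, h1.2, h2.1, h2.2, h3.1, h3.2]
  rw [Prod.norm_mk, max_lt_iff]
  have := norm_nonneg Z.center
  constructor <;> linarith

/-- Existence of solutions for all time from an a priori bound. -/
theorem exists_isSolOn (Z : EstimateSystem A S) {δ M : ℝ} (x₀ : EuclideanSpace ℝ A)
    (hbound : ∀ {T : ℝ} {x : ℝ → EuclideanSpace ℝ A} {w : ℝ → ∀ p, S p → ℝ},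
      Z.IsSolOn δ T x w → x 0 = x₀ → ∀ t ∈ Icc 0 T,
      Z.energy (x t) ≤ M ∧ Z.disagree (x t) (w t) ≤ M) :
    ∃ (x : ℝ → EuclideanSpace ℝ A) (w : ℝ → ∀ p, S p → ℝ), x 0 = x₀ ∧
      ∀ T, Z.IsSolOn δ T x w := by
  obtain ⟨ρ, hρ⟩ := Z.exists_norm_lt M
  obtain ⟨γ, hγ0, hγ⟩ := exists_forward_solution_of_apriori_bound (Z.contDiff_field δ) (x₀, 0)
    (ρ := max ρ (‖(x₀, (0 : ∀ p, S p → ℝ))‖ + 1)) (lt_max_of_lt_right (by linarith))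
    (fun γ T hT h0 h => by
      have hsol := Z.isSolOn_of_hasDerivWithinAt (by rw [h0]) h
      have h1 := hbound hsol (by simp [h0]) T ⟨hT, le_rfl⟩
      exact lt_max_of_lt_left (hρ hsol T ⟨hT, le_rfl⟩ h1.1 h1.2))
  exact ⟨fun t => (γ t).1, fun t => (γ t).2, by simp [hγ0], fun T =>
    Z.isSolOn_of_hasDerivWithinAt (by simp [hγ0]) fun t ht => hγ t ht.1⟩

/-! ### Assembling the KL estimate -/

/-- Semi-global practical stability of the seeking dynamics. -/
theorem exists_isClassKL (Z : EstimateSystem A S) : ∃ φ, IsClassKL φ ∧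
    ∀ Δ v : ℝ, 0 < v → ∃ δstar > 0, ∀ δ, 0 < δ → δ < δstar → ∀ x₀ : EuclideanSpace ℝ A,
      Real.sqrt (Z.disagree x₀ 0 + ‖x₀ - Z.center‖ ^ 2) < Δ →
      (∃ (x : ℝ → EuclideanSpace ℝ A) (w : ℝ → ∀ p, S p → ℝ), x 0 = x₀ ∧
        ∀ T, Z.IsSolOn δ T x w) ∧
      ∀ (T : ℝ) (x : ℝ → EuclideanSpace ℝ A) (w : ℝ → ∀ p, S p → ℝ), Z.IsSolOn δ T x w →
        x 0 = x₀ → ∀ t ∈ Icc 0 T,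
        Real.sqrt (Z.disagree (x t) (w t) + ‖x t - Z.center‖ ^ 2) ≤
          φ (Real.sqrt (Z.disagree (x 0) (w 0) + ‖x 0 - Z.center‖ ^ 2)) (δ * t) + v := by
  obtain ⟨a, ha, ha1, hmono, hdiss⟩ := Z.exists_rate
  have hgap := Z.gap_pos
  set k := ∑ p, Z.energyWeight p with hk
  have hk0 : 0 ≤ k := Finset.sum_nonneg fun p _ => (Z.energyWeight_pos p).le
  set c := ∑ p, 2 / Z.energyWeight p with hc
  have hc0 : 0 ≤ c := Finset.sum_nonneg fun p _ => (div_pos two_pos (Z.energyWeight_pos p)).le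
  refine ⟨_, isClassKL_sqrt_decayProfile_add_exp ha ha1 hc0 hk0
    (μ := Z.gap / 4) (by positivity), fun Δ v hv => ?_⟩
  -- Makes both η and cη at most (v/2)², so disagreement and distance each cost v/2 after the square
  -- root.
  set η := (v / 2) ^ 2 / (c + 1) with hη
  have hη0 : 0 < η := by positivity
  have hηv : η ≤ (v / 2) ^ 2 := div_le_self (sq_nonneg _) (by linarith)
  have hcη : c * η ≤ (v / 2) ^ 2 := by
    rw [hη, mul_div_assoc', div_le_iff₀ (by positivity)]
    nlinarith [sq_nonneg (v / 2)]
  obtain ⟨δ₀, hδ₀, hdecay⟩ := Z.exists_practical_decay ha hmono hdiss (Δ := Δ) hη0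
  refine ⟨min 1 δ₀, by positivity, fun δ hδ hδs x₀ hx₀ => ?_⟩
  rw [lt_min_iff] at hδs
  have hsum0 : 0 ≤ Z.disagree x₀ 0 + ‖x₀ - Z.center‖ ^ 2 :=
    add_nonneg (Z.disagree_nonneg _ _) (sq_nonneg _)
  have hΔ : 0 < Δ := (Real.sqrt_nonneg _).trans_lt hx₀
  have hsq : Z.disagree x₀ 0 + ‖x₀ - Z.center‖ ^ 2 < Δ ^ 2 := (Real.sqrt_lt' hΔ).1 hx₀
  have hx₀' : ‖x₀ - Z.center‖ ≤ Δ :=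
    abs_le_of_sq_le_sq' (by linarith [Z.disagree_nonneg x₀ 0]) hΔ.le |>.2
  have hW₀' : Z.disagree x₀ 0 ≤ Δ ^ 2 := by linarith [sq_nonneg ‖x₀ - Z.center‖]
  have hest : ∀ {T : ℝ} {x : ℝ → EuclideanSpace ℝ A} {w : ℝ → ∀ p, S p → ℝ},
      Z.IsSolOn δ T x w → x 0 = x₀ → ∀ t ∈ Icc 0 T,
        Z.energy (x t) ≤ decayProfile a (Z.energy (x 0)) (δ * t) + η ∧
        Z.disagree (x t) (w t) ≤
          Real.exp (-(Z.gap / 2) * t) * Z.disagree (x 0) (w 0) + η := by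
    intro T x w h h0 t ht
    refine hdecay δ hδ hδs.2 h (by rwa [h0]) (by rwa [h0, h.aux_init]) t ht
  refine ⟨Z.exists_isSolOn (M := max (Z.energy x₀ + 2 * η) (Δ ^ 2 + η)) x₀ ?_, ?_⟩
  · intro T x w h h0 t ht
    obtain ⟨h1, h2⟩ := hest h h0 t ht
    constructor
    · refine le_max_of_le_left (h1.trans ?_)
      have h3 := decayProfile_le a (Z.energy (x 0)) (δ * t) hη0
      have h4 : 0 ≤ δ * t * a η := mul_nonneg (mul_nonneg hδ.le ht.1) (ha η hη0).le
      have h5 : max η (Z.energy (x 0) - δ * t * a η) ≤ Z.energy x₀ + η :=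
        max_le (by linarith [Z.energy_nonneg x₀]) (by rw [h0]; linarith)
      linarith
    · refine le_max_of_le_right (h2.trans (add_le_add ?_ le_rfl))
      rw [h0, h.aux_init]
      refine (mul_le_of_le_one_left (Z.disagree_nonneg _ _) ?_).trans hW₀'
      rw [Real.exp_le_one_iff]
      nlinarith [ht.1]
  · intro T x w h h0 t ht
    obtain ⟨h1, h2⟩ := hest h h0 t ht
    set r := Real.sqrt (Z.disagree (x 0) (w 0) + ‖x 0 - Z.center‖ ^ 2) with hr
    have hr0 : 0 ≤ r := Real.sqrt_nonneg _
    have hrsq : r ^ 2 = Z.disagree (x 0) (w 0) + ‖x 0 - Z.center‖ ^ 2 :=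
      Real.sq_sqrt (add_nonneg (Z.disagree_nonneg _ _) (sq_nonneg _))
    have hv2 : 0 ≤ v / 2 := by linarith
    have hx : ‖x t - Z.center‖ ^ 2 ≤ c * decayProfile a (k * r ^ 2) (δ * t) + (v / 2) ^ 2 := by
      refine (Z.sq_norm_le_energy _).trans ?_
      have h3 : Z.energy (x 0) ≤ k * r ^ 2 := (Z.energy_le _).trans
        (mul_le_mul_of_nonneg_left (by linarith [Z.disagree_nonneg (x 0) (w 0)]) hk0)
      have h4 := h1.trans (add_le_add (decayProfile_mono_left a (δ * t) h3) le_rfl)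
      have h5 := mul_le_mul_of_nonneg_left h4 hc0
      rw [mul_add] at h5
      linarith
    have hW : Z.disagree (x t) (w t) ≤ (r * Real.exp (-(Z.gap / 4) * (δ * t)) + v / 2) ^ 2 := by
      -- For δ ≤ 1 decay in t dominates decay in δt; the rate gap/4 is gap/2 halved by the square
      -- root.
      have h3 : Real.exp (-(Z.gap / 2) * t) ≤ Real.exp (-(Z.gap / 4) * (δ * t)) ^ 2 := by
        rw [← Real.exp_nat_mul]
        refine Real.exp_le_exp.2 ?_
        have h4 : δ * t ≤ t := mul_le_of_le_one_left ht.1 hδs.1.le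
        push_cast
        nlinarith
      have h4 := mul_le_mul h3 (show Z.disagree (x 0) (w 0) ≤ r ^ 2 by
        linarith [sq_nonneg ‖x 0 - Z.center‖]) (Z.disagree_nonneg _ _) (sq_nonneg _)
      have h5 : 0 ≤ r * Real.exp (-(Z.gap / 4) * (δ * t)) * (v / 2) := by positivity
      nlinarith
    set E := r * Real.exp (-(Z.gap / 4) * (δ * t)) with hE
    have hE0 : 0 ≤ E := by positivity
    set P := c * decayProfile a (k * r ^ 2) (δ * t) with hP
    have hP0 : 0 ≤ P := mul_nonneg hc0 (decayProfile_nonneg _ _ _)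
    have hPs := Real.sq_sqrt hP0
    have hPn := Real.sqrt_nonneg P
    refine Real.sqrt_le_iff.2 ⟨by positivity, ?_⟩
    nlinarith [mul_nonneg hE0 hPn, mul_nonneg hPn hv2, mul_nonneg hE0 hv2]

end EstimateSystem

/-! ### Spectral gap and orthogonal completion -/

/-- The Laplacian form of an undirected graph as a sum over pairs. -/
theorem WeightedGraph.two_mul_laplacian {V : Type} [Fintype V] {G : WeightedGraph V}
    (hu : G.IsUndirected) (e : V → ℝ) :
    2 * ∑ l, e l * ∑ l', G.weight l l' * (e l - e l') =
      ∑ l, ∑ l', G.weight l l' * (e l - e l') ^ 2 := by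
  have h1 : ∑ l, e l * ∑ l', G.weight l l' * (e l - e l') =
      ∑ l, ∑ l', G.weight l l' * (e l * (e l - e l')) := by
    refine Finset.sum_congr rfl fun l _ => ?_
    rw [Finset.mul_sum]
    exact Finset.sum_congr rfl fun l' _ => by ring
  have h2 : ∑ l, ∑ l', G.weight l l' * (e l * (e l - e l')) =
      ∑ l, ∑ l', G.weight l l' * (e l' * (e l' - e l)) := by
    rw [Finset.sum_comm]
    exact Finset.sum_congr rfl fun l _ => Finset.sum_congr rfl fun l' _ => by rw [hu l' l]
  rw [two_mul, h1]
  nth_rewrite 2 [h2]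
  rw [← Finset.sum_add_distrib]
  refine Finset.sum_congr rfl fun l _ => ?_
  rw [← Finset.sum_add_distrib]
  exact Finset.sum_congr rfl fun l' _ => by ring

/-- A vector on which the Laplacian form of a connected graph vanishes is constant. -/
theorem WeightedGraph.eq_of_laplacian_nonpos {V : Type} [Fintype V] {G : WeightedGraph V}
    (hu : G.IsUndirected) (hc : G.IsConnected) {e : V → ℝ}
    (h : ∑ l, e l * ∑ l', G.weight l l' * (e l - e l') ≤ 0) (u v : V) : e u = e v := by
  have h1 : ∑ l, ∑ l', G.weight l l' * (e l - e l') ^ 2 = 0 := by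
    refine le_antisymm (by rw [← two_mul_laplacian hu]; linarith) ?_
    exact Finset.sum_nonneg fun l _ => Finset.sum_nonneg fun l' _ =>
      mul_nonneg (G.weight_nonneg _ _) (sq_nonneg _)
  have h2 : ∀ l l', 0 < G.weight l l' → e l = e l' := by
    intro l l' hpos
    have h3 := (Finset.sum_eq_zero_iff_of_nonneg fun l _ => Finset.sum_nonneg fun l' _ =>
      mul_nonneg (G.weight_nonneg l l') (sq_nonneg (e l - e l'))).1 h1 l (Finset.mem_univ _)
    have h4 := (Finset.sum_eq_zero_iff_of_nonneg fun l' _ =>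
      mul_nonneg (G.weight_nonneg l l') (sq_nonneg (e l - e l'))).1 h3 l' (Finset.mem_univ _)
    have h5 := (mul_eq_zero.1 h4).resolve_left hpos.ne'
    exact sub_eq_zero.1 (pow_eq_zero_iff two_ne_zero |>.1 h5)
  induction hc u v with
  | refl => rfl
  | tail _ hbc ih => rw [ih, h2 _ _ hbc]

/-- The spectral gap of a connected undirected graph. -/
theorem WeightedGraph.exists_gap {V : Type} [Fintype V] {G : WeightedGraph V}
    (hu : G.IsUndirected) (hc : G.IsConnected) : ∃ c, 0 < c ∧ ∀ e : V → ℝ, ∑ l, e l = 0 →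
      c * ∑ l, e l ^ 2 ≤ ∑ l, e l * ∑ l', G.weight l l' * (e l - e l') := by
  let Q : EuclideanSpace ℝ V → ℝ := fun e => ∑ l, e l * ∑ l', G.weight l l' * (e l - e l')
  have hQ : Continuous Q := by fun_prop
  -- The gap is the minimum of the form on unit vectors of sum zero, where it is positive since a
  -- constant vector of sum zero vanishes; homogeneity does the rest.
  let s : Set (EuclideanSpace ℝ V) := Metric.sphere 0 1 ∩ {e | ∑ l, e l = 0}
  have hs : IsCompact s := (isCompact_sphere _ _).inter_right
    (isClosed_eq (by fun_prop) continuous_const)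
  have hpos : ∀ e ∈ s, 0 < Q e := by
    rintro e ⟨he1, he0⟩
    by_contra! hle
    have hconst := eq_of_laplacian_nonpos hu hc hle
    have hzero : e = 0 := by
      ext l
      have h1 : ∑ l' : V, e l' = Fintype.card V * e l := by
        rw [Finset.sum_congr rfl fun l' _ => hconst l' l]
        simp
      rw [mem_ofPred_eq, h1] at he0
      have : Nonempty V := ⟨l⟩
      exact (mul_eq_zero.1 he0).resolve_left (Nat.cast_ne_zero.2 Fintype.card_ne_zero)
    simp [hzero] at he1
  have hlow : ∃ c, 0 < c ∧ ∀ e ∈ s, c ≤ Q e := by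
    by_cases hne : s.Nonempty
    · obtain ⟨e, he, hmin⟩ := hs.exists_isMinOn hne hQ.continuousOn
      exact ⟨Q e, hpos e he, fun e' he' => hmin he'⟩
    · exact ⟨1, one_pos, fun e he => absurd ⟨e, he⟩ hne⟩
  obtain ⟨c, hc0, hcs⟩ := hlow
  refine ⟨c, hc0, fun e he => ?_⟩
  set y : EuclideanSpace ℝ V := WithLp.toLp 2 e with hy
  have hn : ∑ l, e l ^ 2 = ‖y‖ ^ 2 := by simp [EuclideanSpace.norm_sq_eq, hy]
  rw [hn]
  by_cases hy0 : y = 0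
  · have he0 : e = 0 := by
      funext l
      exact congrArg (fun y : EuclideanSpace ℝ V => y l) hy0
    simp [hy0, he0]
  · have hyn : 0 < ‖y‖ := norm_pos_iff.2 hy0
    have hmem : ‖y‖⁻¹ • y ∈ s := by
      refine ⟨?_, ?_⟩
      · rw [mem_sphere_zero_iff_norm, norm_smul, norm_inv, norm_norm]
        field_simp
      · simp only [mem_ofPred_eq, PiLp.smul_apply, smul_eq_mul, ← Finset.mul_sum]
        rw [show ∑ l, y l = 0 from he, mul_zero]
    have h1 := hcs _ hmem
    have h2 : Q (‖y‖⁻¹ • y) = (‖y‖ ^ 2)⁻¹ * Q y := by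
      simp only [Q, PiLp.smul_apply, smul_eq_mul]
      rw [Finset.mul_sum]
      refine Finset.sum_congr rfl fun l _ => ?_
      rw [← mul_assoc, Finset.mul_sum, Finset.mul_sum]
      refine Finset.sum_congr rfl fun l' _ => ?_
      field_simp
    rw [h2, ← div_eq_inv_mul, le_div_iff₀ (by positivity)] at h1
    exact h1

/-- A matrix completing the normalized ones vector to an orthogonal matrix turns the squared norm
into the spread. -/
theorem CompletesOnes.sum_sq_mulVec {V : Type} [DecidableEq V] {s : Finset V}
    {R : Matrix s (Fin (s.card - 1)) ℝ} (hR : CompletesOnes s R) (hs : s.Nonempty) (g : s → ℝ) :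
    ∑ k, (R.transpose.mulVec g k) ^ 2 = spread g := by
  have hn : (0 : ℝ) < s.card := Nat.cast_pos.2 hs.card_pos
  have h1 := hR.1
  rw [Matrix.transpose_fromCols, Matrix.fromCols_mul_fromRows] at h1
  set O : Matrix s Unit ℝ := Matrix.of fun _ _ => 1 / Real.sqrt s.card with hO
  have h2 : ∑ k, (R.transpose.mulVec g k) ^ 2 = g ⬝ᵥ (R * R.transpose).mulVec g := by
    rw [← Matrix.mulVec_mulVec, Matrix.dotProduct_mulVec, ← Matrix.mulVec_transpose]
    exact Finset.sum_congr rfl fun k _ => pow_two _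
  have h3 : g ⬝ᵥ (O * O.transpose).mulVec g = (∑ l, g l) ^ 2 / s.card := by
    have h4 : ∀ l, (O * O.transpose).mulVec g l = (∑ l, g l) / s.card := by
      intro l
      have : ∀ l', (O * O.transpose) l l' = 1 / s.card := by
        intro l'
        rw [Matrix.mul_apply, Fintype.sum_unique, Matrix.transpose_apply]
        simp only [hO, Matrix.of_apply]
        rw [div_mul_div_comm, Real.mul_self_sqrt hn.le, one_mul]
      simp only [Matrix.mulVec, dotProduct, this]
      rw [← Finset.mul_sum]
      ring
    simp only [dotProduct, h4]
    rw [← Finset.sum_mul]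
    ring
  -- The rows of the orthogonal matrix make `R * Rᵀ` the projection off the ones vector, whose
  -- quadratic form is the spread.
  have h5 : R * R.transpose = 1 - O * O.transpose := by rw [← h1]; abel
  rw [h2, h5, Matrix.sub_mulVec, dotProduct_sub, h3, Matrix.one_mulVec]
  have h6 : mean g * s.card = ∑ l, g l := by
    rw [mean, Fintype.card_coe]; field_simp
  have h7 : spread g = ∑ l, g l ^ 2 - 2 * mean g * ∑ l, g l + s.card * mean g ^ 2 := by
    simp only [spread, sub_sq, Finset.sum_add_distrib, Finset.sum_sub_distrib, Finset.mul_sum]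
    congr 1
    · congr 1
      exact Finset.sum_congr rfl fun _ _ => by ring
    · simp
  rw [h7, ← h6]
  have h8 : g ⬝ᵥ g = ∑ l, g l ^ 2 := Finset.sum_congr rfl fun _ _ => (pow_two _).symm
  rw [h8]
  field_simp
  ring

/-! ### The coalition game as an estimate system -/

variable {N : ℕ} {m : Fin N → ℕ}

open Classical in
theorem partialDeriv_eq_deriv {h : Profile m → ℝ} (hh : Differentiable ℝ h) (a : Agent m)
    (x : Profile m) :
    partialDeriv h a x = deriv (fun t : ℝ => h (x + t • EuclideanSpace.single a (1 : ℝ))) 0 := by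
  rw [partialDeriv, ← (hh x).lineDeriv_eq_fderiv, lineDeriv]

theorem partialDeriv_eq_zero {h : Profile m → ℝ} (hh : Differentiable ℝ h) {a : Agent m}
    (ha : ¬ ExplicitlyDependsOn h a) (x : Profile m) : partialDeriv h a x = 0 := by
  classical
  rw [partialDeriv_eq_deriv hh]
  have : ∀ t : ℝ, h (x + t • EuclideanSpace.single a (1 : ℝ)) = h x := by
    intro t
    by_contra hne
    refine ha ⟨_, _, fun b hb => ?_, hne⟩
    simp [hb]
  simp only [this, deriv_const]

theorem contDiff_partialDeriv {h : Profile m → ℝ} (hh : ContDiff ℝ 2 h) (a : Agent m) :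
    ContDiff ℝ 1 (partialDeriv h a) :=
  (hh.fderiv_right (m := 1) (by norm_num)).clm_apply contDiff_const

theorem differentiable_coalitionCost {f : Objectives m} (hf : ∀ a, Differentiable ℝ (f a))
    (i : Fin N) : Differentiable ℝ (coalitionCost f i) :=
  Differentiable.fun_sum fun k _ => hf ⟨i, k⟩

/-- Only the closed neighbourhood contributes to the pseudo-gradient. -/
theorem sum_partialDeriv_closedNbhd {f : Objectives m} (hf : ∀ a, Differentiable ℝ (f a))
    (p : Agent m) (x : Profile m) :
    ∑ l : closedNbhd f p, partialDeriv (f ⟨p.1, l⟩) p x = pseudoGradient f x p := by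
  have h1 : pseudoGradient f x p = ∑ k : Fin (m p.1), partialDeriv (f ⟨p.1, k⟩) p x := by
    have h2 : fderiv ℝ (coalitionCost f p.1) x = ∑ k : Fin (m p.1), fderiv ℝ (f ⟨p.1, k⟩) x :=
      fderiv_fun_sum fun k _ => hf ⟨p.1, k⟩ x
    simp only [pseudoGradient, partialDeriv, h2, sum_apply]
  rw [h1, Finset.sum_coe_sort (closedNbhd f p) fun l => partialDeriv (f ⟨p.1, l⟩) p x]
  -- An objective outside the closed neighbourhood does not involve the action of `p`, so its
  -- partial derivative is zero.
  refine Finset.sum_subset (Finset.subset_univ _) fun l _ hl => ?_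
  refine partialDeriv_eq_zero (hf _) (fun hdep => hl ?_) x
  simp only [closedNbhd, Finset.mem_filter, Finset.mem_univ, true_and]
  by_cases hlp : l = p.2
  · exact Or.inl hlp
  · exact Or.inr ⟨Ne.symm hlp, Or.inr hdep⟩

/-- Changing one coordinate is a unilateral deviation of its coalition, so the coalition cost has a
minimum along that line. -/
theorem IsNashEquilibrium.pseudoGradient_eq_zero {f : Objectives m}
    (hf : ∀ a, Differentiable ℝ (f a)) {xstar : Profile m} (h : IsNashEquilibrium f xstar)
    (a : Agent m) : pseudoGradient f xstar a = 0 := by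
  classical
  change partialDeriv (coalitionCost f a.1) a xstar = 0
  rw [partialDeriv_eq_deriv (differentiable_coalitionCost hf a.1)]
  refine IsLocalMin.deriv_eq_zero (Eventually.of_forall fun t => ?_)
  beta_reduce
  rw [zero_smul, add_zero]
  refine h a.1 _ fun b hb => ?_
  have hne : b ≠ a := fun hba => hb (by rw [hba])
  simp [hne]

theorem subsingleton_closedNbhd (f : Objectives m) {j : Fin N} (hj : m j = 1) {p : Agent m}
    (hp : p.1 = j) : Subsingleton (closedNbhd f p) := by
  have : Subsingleton (Fin (m p.1)) := by
    rw [hp, hj]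
    infer_instance
  infer_instance

theorem spread_of_subsingleton {ι : Type*} [Fintype ι] [Subsingleton ι] (u : ι → ℝ) :
    spread u = 0 := by
  rcases isEmpty_or_nonempty ι with h | ⟨⟨i⟩⟩
  · simp [spread]
  · have : Unique ι := uniqueOfSubsingleton i
    simp [spread, mean]

/-- Each block RᵀG contributes its spread. Adding coalition `j` to the sum costs nothing: its only
agent has one estimator, of zero spread. -/
theorem sq_norm_reducedState (f : Objectives m)
    (R : ∀ p : Agent m, Matrix (closedNbhd f p) (Fin ((closedNbhd f p).card - 1)) ℝ)
    (hR : ∀ p, CompletesOnes (closedNbhd f p) (R p)) (xstar : Profile m) {j : Fin N}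
    (hj : m j = 1) (x : Profile m) (w : AuxState f) :
    ‖reducedState f R xstar j x w‖ ^ 2 =
      ∑ p, spread (gradEst f x w p) + ‖x - xstar‖ ^ 2 := by
  classical
  rw [EuclideanSpace.norm_sq_eq, EuclideanSpace.norm_sq_eq, Fintype.sum_sum_type]
  congr 1
  · rw [Fintype.sum_sigma]
    have h1 : ∀ p : {p : Agent m // p.1 ≠ j}, ∑ k : Fin ((closedNbhd f p.1).card - 1),
        ‖reducedState f R xstar j x w (Sum.inl ⟨p, k⟩)‖ ^ 2 = spread (gradEst f x w p.1) := by
      intro p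
      rw [← (hR p.1).sum_sq_mulVec ⟨_, self_mem_closedNbhd f p.1⟩]
      refine Finset.sum_congr rfl fun k _ => ?_
      rw [Real.norm_eq_abs, sq_abs]
      rfl
    rw [Finset.sum_congr rfl fun p _ => h1 p]
    have h2 : ∀ p ∈ (Finset.univ : Finset (Agent m)), p ∉ Finset.univ.filter (fun p => p.1 ≠ j) →
        spread (gradEst f x w p) = 0 := by
      intro p _ hp
      have := subsingleton_closedNbhd f hj (p := p) (by simpa using hp)
      exact spread_of_subsingleton _
    rw [← Finset.sum_subset (Finset.subset_univ _) h2]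
    exact (Finset.sum_subtype _ (by simp) fun p => spread (gradEst f x w p)).symm

end CoalitionGame

open CoalitionGame in
theorem corollary1 {N : ℕ} (hN : 2 ≤ N) (m : Fin N → ℕ) (hm : ∀ i, 1 ≤ m i)
    (j : Fin N) (hj : m j = 1)
    (f : CoalitionGame.Objectives m)
    (hsmooth : ∀ a : CoalitionGame.Agent m, ContDiff ℝ 2 (f a))
    (hmono : ∀ x y : CoalitionGame.Profile m, x ≠ y →
      0 < inner ℝ (x - y) (CoalitionGame.pseudoGradient f x - CoalitionGame.pseudoGradient f y))
    (xstar : CoalitionGame.Profile m) (hstar : CoalitionGame.IsNashEquilibrium f xstar)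
    (GC : ∀ i : Fin N, CoalitionGame.WeightedGraph (Fin (m i)))
    (hGI : ∀ i : Fin N, i ≠ j → (CoalitionGame.interferenceGraph f i).Connected)
    (hGC : ∀ p : CoalitionGame.Agent m, p.1 ≠ j →
      (CoalitionGame.interferenceCommGraph f GC p).IsUndirected ∧
      (CoalitionGame.interferenceCommGraph f GC p).IsConnected)
    (dbar : CoalitionGame.Agent m → ℝ) (hdbar : ∀ a, 0 < dbar a)
    (R : ∀ p : CoalitionGame.Agent m, Matrix (CoalitionGame.closedNbhd f p)
      (Fin ((CoalitionGame.closedNbhd f p).card - 1)) ℝ)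
    (hR : ∀ p, CoalitionGame.CompletesOnes (CoalitionGame.closedNbhd f p) (R p)) :
    ∃ φ : ℝ → ℝ → ℝ, CoalitionGame.IsClassKL φ ∧
      ∀ Δ v : ℝ, 0 < Δ → 0 < v → ∃ δstar : ℝ, 0 < δstar ∧
        ∀ δ : ℝ, 0 < δ → δ < δstar →
          ∀ x₀ : CoalitionGame.Profile m,
            ‖CoalitionGame.reducedState f R xstar j x₀ 0‖ < Δ →
            (∃ (x : ℝ → CoalitionGame.Profile m) (w : ℝ → CoalitionGame.AuxState f),
              CoalitionGame.IsTrajectory f GC dbar δ x w ∧ x 0 = x₀) ∧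
            ∀ (x : ℝ → CoalitionGame.Profile m) (w : ℝ → CoalitionGame.AuxState f),
              CoalitionGame.IsTrajectory f GC dbar δ x w → x 0 = x₀ →
              ∀ t : ℝ, 0 ≤ t →
                ‖CoalitionGame.reducedState f R xstar j (x t) (w t)‖ ≤
                  φ ‖CoalitionGame.reducedState f R xstar j (x 0) (w 0)‖ (δ * t) + v := by
  have hdiff : ∀ a, Differentiable ℝ (f a) := fun a => (hsmooth a).differentiable two_ne_zero
  have hgraph : ∀ p : Agent m, (interferenceCommGraph f GC p).IsUndirected ∧
      (interferenceCommGraph f GC p).IsConnected := by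
    intro p
    -- The graph of the single-agent coalition has one vertex, so it is undirected and connected
    -- without any assumption.
    by_cases hp : p.1 = j
    · have := subsingleton_closedNbhd f hj hp
      refine ⟨fun u v => ?_, fun u v => ?_⟩
      · rw [Subsingleton.elim u v]
      · rw [Subsingleton.elim u v]
    · exact hGC p hp
  choose gap hgap0 hgap using fun p => WeightedGraph.exists_gap (hgraph p).1 (hgraph p).2
  have : Nonempty (Agent m) := ⟨⟨j, ⟨0, hm j⟩⟩⟩
  -- One gap valid for all agents: the smallest of finitely many.
  obtain ⟨p₀, hp₀⟩ := Finite.exists_min gap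
  let Z : EstimateSystem (Agent m) (fun p => closedNbhd f p) :=
    { share := fun p l => partialDeriv (f ⟨p.1, l⟩) p
      coupling := fun p l l' => (GC p.1).weight l l'
      own := fun p => ⟨p.2, self_mem_closedNbhd f p⟩
      gain := dbar
      gap := gap p₀
      center := xstar
      contDiff_share := fun p l => contDiff_partialDeriv (hsmooth _) p
      coupling_symm := fun p l l' => (hgraph p).1 l l'
      gain_pos := hdbar
      gap_pos := hgap0 p₀
      gap_le := fun p e he => (mul_le_mul_of_nonneg_right (hp₀ p)
        (Finset.sum_nonneg fun _ _ => sq_nonneg _)).trans (hgap p e he)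
      sum_share_center := fun p => by
        rw [sum_partialDeriv_closedNbhd hdiff, hstar.pseudoGradient_eq_zero hdiff]
      strictMono_sum_share := fun x y hxy => by
        have h := hmono x y hxy
        rw [PiLp.inner_apply] at h
        simp only [sum_partialDeriv_closedNbhd hdiff]
        refine h.trans_eq (Finset.sum_congr rfl fun p _ => ?_)
        simp [mul_comm] }
  have hnorm : ∀ x w, ‖reducedState f R xstar j x w‖ =
      Real.sqrt (Z.disagree x w + ‖x - Z.center‖ ^ 2) := by
    intro x w
    rw [← Real.sqrt_sq (norm_nonneg (reducedState f R xstar j x w)),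
      sq_norm_reducedState f R hR xstar hj]
    rfl
  obtain ⟨φ, hφ, h⟩ := Z.exists_isClassKL
  refine ⟨φ, hφ, fun Δ v _ hv => ?_⟩
  obtain ⟨δstar, hδstar, h⟩ := h Δ v hv
  refine ⟨δstar, hδstar, fun δ hδ hδs x₀ hx₀ => ?_⟩
  rw [hnorm] at hx₀
  obtain ⟨⟨x, w, hx0, hsol⟩, hest⟩ := h δ hδ hδs x₀ hx₀
  refine ⟨⟨x, w, ⟨(hsol 0).aux_init, fun t ht p => (hsol t).action_deriv t ⟨ht, le_rfl⟩ p,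
    fun t ht p l => (hsol t).aux_deriv t ⟨ht, le_rfl⟩ p l⟩, hx0⟩, fun x w htr hx0 t ht => ?_⟩
  rw [hnorm, hnorm]
  exact hest t x w ⟨htr.aux_init, fun s hs p => htr.action_deriv s hs.1 p,
    fun s hs p l => htr.aux_deriv s hs.1 p l⟩ hx0 t ⟨ht, le_rfl⟩
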